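/- Let $M\subset\mathbb{R}^2$ be open, $\Sigma=\{(x,y)\in M:\ y=0\}$, $h(x,y)=y$, $M^{\pm}=\{(x,y)\in M:\ \pm y>0\}$. Let $n\ge 2$ and $n+1\le r\le\infty$, and let $\chi^r$ be the space of $C^r$ vector fields on $M$ with the $C^r$ topology (uniform convergence on compact subsets of $M$ of the derivatives of all finite orders $\le r$). For $X\in\chi^r$ let $\varphi_X$ be its flow, and let $X^ih$ be the $i$-fold Lie derivative of $h$ along $X$. Let $X_0=(X_{0,1},X_{0,2})\in\chi^r$ have a contact of order $n$ with $\Sigma$ at the origin $(0,0)\in M$: $X_0^ih(0,0)=0$ for $1\le i\le n-1$ and $X_0^nh(0,0)\neq0$. Let $q_0=(x_0,y_0)=\varphi_{X_0}(t_0;0,0)$ for some $t_0\ne0$ (of either sign), such that the orbit arc of $X_0$ between $(0,0)$ and $q_0$ lies, except for its end point $(0,0)$, entirely in $M^+$ or entirely in $M^-$, and such that $X_{0,1}\ne0$ along this arc. Put $\delta=\operatorname{sgn}X_{0,1}(0,0)\in\{1,-1\}$. Let $\rho>0$ be such that $\tau=\{x_0\}\times(y_0-\rho,y_0+\rho)$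 is contained in $M$, lies on the same side of $\Sigma$ as $q_0$, and is transversal to $X_0$. Then there are an open neighbourhood $\mathcal U_0$ of $X_0$ in $\chi^r$ and numbers $\varepsilon,\theta,\eta>0$ such that for each $X\in\mathcal U_0$ the full transition map $T_X:(-\varepsilon,\varepsilon)\times\{0\}\to\tau$ is defined: the orbit of $X$ through $(x,0)$, $|x|<\varepsilon$, meets $\tau$ at exactly one time in $(t_0-\theta,t_0+\theta)$, and $T_X(x,0)$ is the point where it does so. Moreover there are functions $\lambda_0,\kappa,\lambda_1,\dots,\lambda_{n-2}:\mathcal U_0\to\mathbb{R}$ and, for each $X\in\mathcal U_0$, a $C^r$ diffeomorphism $h_X$ of $(-\varepsilon,\varepsilon)$ onto itself, with $(X,x)\mapsto h_X(x)$ continuous on $\mathcal U_0\times(-\varepsilon,\varepsilon)$ and $h_{X_0}(0)=0$, such that for each $X\in\mathcal U_0$ $$T_X(h_X(x),0)=\Big(x_0,\ \lambda_0(X)+\kappa(X)x^n+\sum_{i=1}^{n-2}\lambda_i(X)x^i+\mathcal O(x^{n+1})\Big)\qquad(x\to0),$$ where: - $\lambda_0(X)$ is the second coordinate of $T_X(h_X(0),0)$;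 - $\operatorname{sgn}\kappa(X)=-\delta^n\operatorname{sgn}(X^nh(0,0))$; - $\lambda_0,\lambda_1,\dots,\lambda_{n-2}$ are continuous on $\mathcal U_0$; - $(\lambda_1,\dots,\lambda_{n-2})$ maps $\mathcal U_0$ onto the cube $(-\eta,\eta)^{n-2}$; in particular each $\lambda_i:\mathcal U_0\to(-\eta,\eta)$, $1\le i\le n-2$, is surjective. -/

import Mathlib

open Set Filter Topology Asymptotics
open scoped UniformConvergence

/-- The space `χ^r` of vector fields of class `C^r` on the open set `M ⊆ ℝ²`.  A field on `M` is
represented by its extension by zero to the whole plane, so that two elements are equal exactly when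
they agree on `M`. -/
structure CrVectorField (M : Set (ℝ × ℝ)) (r : ℕ∞) where
  toFun : ℝ × ℝ → ℝ × ℝ
  contDiffOn : ContDiffOn ℝ r toFun M
  eq_zero_of_notMem : ∀ p, p ∉ M → toFun p = 0

instance (M : Set (ℝ × ℝ)) (r : ℕ∞) :
    CoeFun (CrVectorField M r) (fun _ => ℝ × ℝ → ℝ × ℝ) :=
  ⟨CrVectorField.toFun⟩

/-- The `C^r` topology: uniform convergence on the compact subsets of `M` of all derivatives of
(finite) order `k ≤ r`. -/
noncomputable instance (M : Set (ℝ × ℝ)) (r : ℕ∞) : TopologicalSpace (CrVectorField M r) :=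
  ⨅ k : {k : ℕ // (k : ℕ∞) ≤ r},
    TopologicalSpace.induced
      (fun X : CrVectorField M r =>
        UniformOnFun.ofFun {K : Set (ℝ × ℝ) | IsCompact K ∧ K ⊆ M}
          (iteratedFDeriv ℝ (k : ℕ) X.toFun))
      inferInstance

/-- The Lie derivative `Xg(p) = ⟨X(p), ∇g(p)⟩` of `g` along `X`. -/
noncomputable def lieDerivAlong (X : ℝ × ℝ → ℝ × ℝ) (g : ℝ × ℝ → ℝ) : ℝ × ℝ → ℝ :=
  fun p => fderiv ℝ g p (X p)

/-- The iterated Lie derivative `X^i h` of `h(x, y) = y`, the function with `Σ = h⁻¹(0)`. -/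
noncomputable def lieIterHeight (X : ℝ × ℝ → ℝ × ℝ) (i : ℕ) : ℝ × ℝ → ℝ :=
  (lieDerivAlong X)^[i] Prod.snd

/-- `X` has a contact of order `n` with `Σ = {y = 0}` at the point `p` of `Σ`. -/
def HasContactOfOrder (X : ℝ × ℝ → ℝ × ℝ) (n : ℕ) (p : ℝ × ℝ) : Prop :=
  p.2 = 0 ∧ (∀ i, 1 ≤ i → i < n → lieIterHeight X i p = 0) ∧ lieIterHeight X n p ≠ 0

/-- On the closed time interval with end points `0` and `t` (where `t` may be negative), `γ` is the
integral curve in `M` of `X` with `γ 0 = p`; that is, `γ s = φ_X(s; p)` there. -/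
structure IsOrbitArc (M : Set (ℝ × ℝ)) (X : ℝ × ℝ → ℝ × ℝ) (γ : ℝ → ℝ × ℝ) (p : ℝ × ℝ) (t : ℝ) :
    Prop where
  start : γ 0 = p
  mem : ∀ s ∈ uIcc 0 t, γ s ∈ M
  deriv : ∀ s ∈ uIcc 0 t, HasDerivWithinAt γ (X (γ s)) (uIcc 0 t) s

/-- `φ_X(t; p)` is defined and equal to `q`. -/
def FlowsTo (M : Set (ℝ × ℝ)) (X : ℝ × ℝ → ℝ × ℝ) (p : ℝ × ℝ) (t : ℝ) (q : ℝ × ℝ) : Prop :=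
  ∃ γ : ℝ → ℝ × ℝ, IsOrbitArc M X γ p t ∧ γ t = q

/-- `x ↦ (q.1, T x)` is the full transition map of `X` from `(-ε, ε) × {0} ⊆ Σ` to the vertical
section `τ = {q.1} × (q.2 - ρ, q.2 + ρ)`: the orbit of `(x, 0)` meets `τ` at exactly one time `s x`
in the window `(t₀ - θ, t₀ + θ)`, and it does so at the point `(q.1, T x)`. -/
def IsFullTransitionMap (M : Set (ℝ × ℝ)) (X : ℝ × ℝ → ℝ × ℝ) (q : ℝ × ℝ) (t₀ θ ρ ε : ℝ)
    (T : ℝ → ℝ) : Prop :=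
  ∃ s : ℝ → ℝ, ∀ x ∈ Ioo (-ε) ε,
    s x ∈ Ioo (t₀ - θ) (t₀ + θ) ∧
    T x ∈ Ioo (q.2 - ρ) (q.2 + ρ) ∧
    FlowsTo M X (x, 0) (s x) (q.1, T x) ∧
    ∀ t ∈ Ioo (t₀ - θ) (t₀ + θ), ∀ y ∈ Ioo (q.2 - ρ) (q.2 + ρ),
      FlowsTo M X (x, 0) t (q.1, y) → t = s x ∧ y = T x

/-- `h` restricts to a diffeomorphism of class `C^r` of the interval `I` onto itself. -/
def IsCrDiffeoOn (r : ℕ∞) (h : ℝ → ℝ) (I : Set ℝ) : Prop :=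
  ContDiffOn ℝ r h I ∧ MapsTo h I I ∧
    ∃ g : ℝ → ℝ, ContDiffOn ℝ r g I ∧ MapsTo g I I ∧ LeftInvOn g h I ∧ RightInvOn g h I

/-! Where the first component of the field does not vanish, orbits are graphs of solutions of the
scalar equation dy/dx = X₂/X₁. Let y_X(x, b) be the solution with value b at x = x₀. The transition
map sends a to the number T_X(a) with y_X(a, T_X(a)) = 0. After a cutoff outside a compact
neighbourhood of the arc everything is globally defined, and T_X is of class C^(n+1) in a with
derivatives jointly continuous in (X, a) (`exists_isGraphFlow`,
`IsCutoff.exists_isFullTransitionMap`). Nothing is ever differentiated in X: the space of fields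
serves only as a topological space of parameters.

Two solutions differ by their difference at x₀ times a positive factor e, so T_X₀(a) - T_X₀(0) =
-y_X₀(a, T_X₀(0)) / e. By the contact condition the height along the orbit of the origin is L tⁿ/n!
+ o(tⁿ) with L = X₀ⁿh(0, 0). Hence the derivatives of T_X₀ at 0 of orders 1 to n-1 vanish, and the
n-th is -L/(E vⁿ), where E > 0 and v is the first component of X₀ at the origin
(`IsCutoff.iteratedDeriv_of_contact`). So the (n-1)-st derivative has a simple zero at 0, which
persists for nearby X as a zero α(X) continuous in X (`exists_continuousOn_zero`). Moving the base
point to α(X) by a translation, cut off to a diffeomorphism of the interval, removes the term of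
order n-1; the Taylor coefficients of T_X at α(X) are then the λᵢ and κ.

For surjectivity, X₀ is pulled back under shears which fix the line x = x₀. This prescribes the
(n-1)-jet of the transition map at 0, continuously in the field (`IsCutoff.exists_jet_family`). If
the prescribed coefficient of order n-1 is zero, then α = 0 and the λᵢ are the prescribed numbers.
-/

/-! ### Families of C^k functions depending continuously on a parameter. -/

section Families

variable {Λ Λ' : Type*} [TopologicalSpace Λ] [TopologicalSpace Λ']
  {E E' F G H : Type}
  [NormedAddCommGroup E] [NormedSpace ℝ E] [NormedAddCommGroup E'] [NormedSpace ℝ E']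
  [NormedAddCommGroup F] [NormedSpace ℝ F] [NormedAddCommGroup G] [NormedSpace ℝ G]
  [NormedAddCommGroup H] [NormedSpace ℝ H]

/-- A family `g` of functions is of class `C^k` on `S`, with all derivatives of order at most `k`
jointly continuous in the parameter and the variable. -/
def ContDiffFamilyOn (k : ℕ) (g : Λ → E → F) (S : Set (Λ × E)) : Prop :=
  (∀ z ∈ S, ContDiffAt ℝ k (g z.1) z.2) ∧
    ∀ j ≤ k, ContinuousOn (fun z : Λ × E => iteratedFDeriv ℝ j (g z.1) z.2) S

namespace ContDiffFamilyOn

theorem of_le {k l : ℕ} {g : Λ → E → F} {S : Set (Λ × E)} (h : ContDiffFamilyOn k g S)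
    (hl : l ≤ k) : ContDiffFamilyOn l g S :=
  ⟨fun z hz => (h.1 z hz).of_le (by exact_mod_cast hl), fun j hj => h.2 j (hj.trans hl)⟩

theorem mono {k : ℕ} {g : Λ → E → F} {S S' : Set (Λ × E)} (h : ContDiffFamilyOn k g S)
    (hS : S' ⊆ S) : ContDiffFamilyOn k g S' :=
  ⟨fun z hz => h.1 z (hS hz), fun j hj => (h.2 j hj).mono hS⟩

theorem continuousOn {k : ℕ} {g : Λ → E → F} {S : Set (Λ × E)} (h : ContDiffFamilyOn k g S) :
    ContinuousOn (fun z : Λ × E => g z.1 z.2) S := by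
  have := (continuousMultilinearCurryFin0 ℝ E F).continuous.comp_continuousOn (h.2 0 (Nat.zero_le _))
  refine this.congr fun z _ => ?_
  simp

theorem continuous {k : ℕ} {g : Λ → E → F} (h : ContDiffFamilyOn k g univ) :
    Continuous (fun z : Λ × E => g z.1 z.2) :=
  continuousOn_univ.1 h.continuousOn

theorem zero_iff {g : Λ → E → F} {S : Set (Λ × E)} (hS : IsOpen S) :
    ContDiffFamilyOn 0 g S ↔ ContinuousOn (fun z : Λ × E => g z.1 z.2) S := by
  refine ⟨fun h => h.continuousOn, fun h => ⟨fun z hz => ?_, fun j hj => ?_⟩⟩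
  · have : ∀ᶠ p in 𝓝 z.2, (z.1, p) ∈ S :=
      (Continuous.prodMk_right z.1).continuousAt.eventually (hS.mem_nhds hz)
    rw [Nat.cast_zero, contDiffAt_zero]
    refine ⟨_, this, fun p hp => ?_⟩
    exact ((h.continuousAt (hS.mem_nhds hp)).comp
      (Continuous.prodMk_right z.1).continuousAt).continuousWithinAt
  · obtain rfl : j = 0 := by omega
    refine ((continuousMultilinearCurryFin0 ℝ E F).symm.continuous.comp_continuousOn h).congr
      fun z _ => ?_
    ext m
    simp

/-- Currying the last variable identifies the derivative of order j + 1 with the j-th derivative of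
`fderiv`. This makes induction on `k` available for the closure properties below, with no formula
for higher derivatives. -/
theorem succ_iff {k : ℕ} {g : Λ → E → F} {S : Set (Λ × E)} (hS : IsOpen S) :
    ContDiffFamilyOn (k + 1) g S ↔ (∀ z ∈ S, DifferentiableAt ℝ (g z.1) z.2) ∧
      ContinuousOn (fun z : Λ × E => g z.1 z.2) S ∧
      ContDiffFamilyOn k (fun l => fderiv ℝ (g l)) S := by
  constructor
  · intro h
    refine ⟨fun z hz => (h.1 z hz).differentiableAt (by simp), h.continuousOn,
      fun z hz => (h.1 z hz).fderiv_right (by norm_cast), fun j hj => ?_⟩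
    have := (continuousMultilinearCurryRightEquiv' ℝ j E F).continuous.comp_continuousOn
      (h.2 (j + 1) (by omega))
    refine this.congr fun z _ => ?_
    simp [iteratedFDeriv_succ_eq_comp_right]
  · rintro ⟨h1, h2, h3⟩
    refine ⟨fun z hz => ?_, fun j hj => ?_⟩
    · have : ∀ᶠ p in 𝓝 z.2, (z.1, p) ∈ S :=
        (Continuous.prodMk_right z.1).continuousAt.eventually (hS.mem_nhds hz)
      push_cast
      rw [contDiffAt_succ_iff_hasFDerivAt]
      exact ⟨fderiv ℝ (g z.1), ⟨_, this, fun p hp => (h1 _ hp).hasFDerivAt⟩, h3.1 z hz⟩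
    · rcases j with _ | j
      · exact ((zero_iff hS).2 h2).2 0 le_rfl
      · have := (continuousMultilinearCurryRightEquiv' ℝ j E F).symm.continuous.comp_continuousOn
          (h3.2 j (by omega))
        refine this.congr fun z _ => ?_
        simp [iteratedFDeriv_succ_eq_comp_right]

theorem fderiv_family {k : ℕ} {g : Λ → E → F} {S : Set (Λ × E)} (hS : IsOpen S)
    (h : ContDiffFamilyOn (k + 1) g S) : ContDiffFamilyOn k (fun l => fderiv ℝ (g l)) S :=
  ((succ_iff hS).1 h).2.2

theorem of_fderiv {k : ℕ} {g : Λ → E → F} {g' : Λ → E → E →L[ℝ] F} {S : Set (Λ × E)}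
    (hS : IsOpen S) (hg : ContinuousOn (fun z : Λ × E => g z.1 z.2) S)
    (hd : ∀ z ∈ S, HasFDerivAt (g z.1) (g' z.1 z.2) z.2) (h : ContDiffFamilyOn k g' S) :
    ContDiffFamilyOn (k + 1) g S := by
  have hev : ∀ z ∈ S, fderiv ℝ (g z.1) =ᶠ[𝓝 z.2] g' z.1 := fun z hz => by
    have : ∀ᶠ p in 𝓝 z.2, (z.1, p) ∈ S :=
      (Continuous.prodMk_right z.1).continuousAt.eventually (hS.mem_nhds hz)
    filter_upwards [this] with p hp using (hd _ hp).fderiv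
  refine (succ_iff hS).2 ⟨fun z hz => (hd z hz).differentiableAt, hg,
    fun z hz => (h.1 z hz).congr_of_eventuallyEq (hev z hz), fun j hj => ?_⟩
  exact (h.2 j hj).congr fun z hz => ((hev z hz).iteratedFDeriv ℝ j).eq_of_nhds

theorem of_forall_mem_nhds {k : ℕ} {g : Λ → E → F} {S : Set (Λ × E)}
    (h : ∀ z ∈ S, ∃ S' ∈ 𝓝 z, ContDiffFamilyOn k g S') : ContDiffFamilyOn k g S := by
  refine ⟨fun z hz => ?_, fun j hj z hz => ?_⟩
  · obtain ⟨S', hS', h'⟩ := h z hz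
    exact h'.1 z (mem_of_mem_nhds hS')
  · obtain ⟨S', hS', h'⟩ := h z hz
    exact ((h'.2 j hj).continuousAt hS').continuousWithinAt

theorem congr {k : ℕ} {g g' : Λ → E → F} {S : Set (Λ × E)} (hS : IsOpen S)
    (h : ContDiffFamilyOn k g S) (he : ∀ z ∈ S, g' z.1 z.2 = g z.1 z.2) :
    ContDiffFamilyOn k g' S := by
  have hev : ∀ z ∈ S, g' z.1 =ᶠ[𝓝 z.2] g z.1 := fun z hz => by
    have : ∀ᶠ p in 𝓝 z.2, (z.1, p) ∈ S :=
      (Continuous.prodMk_right z.1).continuousAt.eventually (hS.mem_nhds hz)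
    filter_upwards [this] with p hp using he _ hp
  exact ⟨fun z hz => (h.1 z hz).congr_of_eventuallyEq (hev z hz),
    fun j hj => (h.2 j hj).congr fun z hz => ((hev z hz).iteratedFDeriv ℝ j).eq_of_nhds⟩

theorem of_contDiffOn {k : ℕ} {g : E → F} {s : Set E} (hs : IsOpen s) (hg : ContDiffOn ℝ k g s) :
    ContDiffFamilyOn k (fun _ : Λ => g) (univ ×ˢ s) := by
  refine ⟨fun z hz => hg.contDiffAt (hs.mem_nhds hz.2), fun j hj => ?_⟩
  have : ContinuousOn (iteratedFDeriv ℝ j g) s := by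
    refine (hg.continuousOn_iteratedFDerivWithin (by exact_mod_cast hj)
      hs.uniqueDiffOn).congr fun p hp => ?_
    exact (iteratedFDerivWithin_of_isOpen j hs hp).symm
  exact this.comp continuousOn_snd fun z hz => hz.2

theorem of_contDiff {k : ℕ} {g : E → F} (hg : ContDiff ℝ k g) :
    ContDiffFamilyOn k (fun _ : Λ => g) univ := by
  simpa using of_contDiffOn (Λ := Λ) isOpen_univ hg.contDiffOn

theorem of_continuous_param {k : ℕ} {c : Λ → F} (hc : Continuous c) :
    ContDiffFamilyOn k (fun (l : Λ) (_ : E) => c l) univ := by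
  refine ⟨fun z _ => contDiffAt_const, fun j _ => ?_⟩
  rcases j with _ | j
  · exact ((zero_iff (g := fun (l : Λ) (_ : E) => c l) isOpen_univ).2
      (hc.comp continuous_fst).continuousOn).2 0 le_rfl
  · simp only [iteratedFDeriv_succ_const]
    exact continuousOn_const

theorem clm_comp {k : ℕ} {g : Λ → E → F} {S : Set (Λ × E)} (L : F →L[ℝ] G)
    (h : ContDiffFamilyOn k g S) : ContDiffFamilyOn k (fun l p => L (g l p)) S := by
  refine ⟨fun z hz => L.contDiff.contDiffAt.comp z.2 (h.1 z hz), fun j hj => ?_⟩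
  have := (ContinuousLinearMap.compContinuousMultilinearMapL ℝ (fun _ : Fin j => E) F G
    L).continuous.comp_continuousOn (h.2 j hj)
  refine this.congr fun z hz => ?_
  exact L.iteratedFDeriv_comp_left (h.1 z hz) (by exact_mod_cast hj)

theorem add {k : ℕ} {g h : Λ → E → F} {S : Set (Λ × E)}
    (hg : ContDiffFamilyOn k g S) (hh : ContDiffFamilyOn k h S) :
    ContDiffFamilyOn k (fun l p => g l p + h l p) S := by
  refine ⟨fun z hz => (hg.1 z hz).add (hh.1 z hz), fun j hj => ?_⟩
  refine ((hg.2 j hj).add (hh.2 j hj)).congr fun z hz => ?_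
  exact iteratedFDeriv_add_apply ((hg.1 z hz).of_le (by exact_mod_cast hj))
    ((hh.1 z hz).of_le (by exact_mod_cast hj))

theorem bilinear {k : ℕ} {S : Set (Λ × E)} (hS : IsOpen S) (B : F →L[ℝ] G →L[ℝ] H)
    {g : Λ → E → F} {h : Λ → E → G}
    (hg : ContDiffFamilyOn k g S) (hh : ContDiffFamilyOn k h S) :
    ContDiffFamilyOn k (fun l p => B (g l p) (h l p)) S := by
  have h0 : ContinuousOn (fun z : Λ × E => B (g z.1 z.2) (h z.1 z.2)) S :=
    (B.continuous.comp_continuousOn hg.continuousOn).clm_apply hh.continuousOn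
  -- The target spaces vary in the induction: the product rule replaces `B` by `precompR` and
  -- `precompL`, which take values in spaces of linear maps.
  induction k generalizing F G H with
  | zero => exact (zero_iff hS).2 h0
  | succ k ih =>
    have hg' := (succ_iff hS).1 hg
    have hh' := (succ_iff hS).1 hh
    refine of_fderiv (g' := fun l p => B.precompR E (g l p) (fderiv ℝ (h l) p) +
      B.precompL E (fderiv ℝ (g l) p) (h l p)) hS h0
      (fun z hz => B.hasFDerivAt_of_bilinear (hg'.1 z hz).hasFDerivAt
      (hh'.1 z hz).hasFDerivAt) (add ?_ ?_)
    · refine ih (B.precompR E) (hg.of_le (by omega)) hh'.2.2 ?_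
      exact ((B.precompR E).continuous.comp_continuousOn hg.continuousOn).clm_apply
        hh'.2.2.continuousOn
    · refine ih (B.precompL E) hg'.2.2 (hh.of_le (by omega)) ?_
      exact ((B.precompL E).continuous.comp_continuousOn hg'.2.2.continuousOn).clm_apply
        hh.continuousOn

theorem prodMk {k : ℕ} {S : Set (Λ × E)} {g : Λ → E → F} {h : Λ → E → G}
    (hg : ContDiffFamilyOn k g S) (hh : ContDiffFamilyOn k h S) :
    ContDiffFamilyOn k (fun l p => (g l p, h l p)) S := by
  have := (hg.clm_comp (ContinuousLinearMap.inl ℝ F G)).add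
    (hh.clm_comp (ContinuousLinearMap.inr ℝ F G))
  simpa using this

theorem mul {k : ℕ} {S : Set (Λ × E)} (hS : IsOpen S) {g h : Λ → E → ℝ}
    (hg : ContDiffFamilyOn k g S) (hh : ContDiffFamilyOn k h S) :
    ContDiffFamilyOn k (fun l p => g l p * h l p) S :=
  bilinear hS (ContinuousLinearMap.mul ℝ ℝ) hg hh

theorem neg {k : ℕ} {S : Set (Λ × E)} {g : Λ → E → F}
    (hg : ContDiffFamilyOn k g S) : ContDiffFamilyOn k (fun l p => - g l p) S := by
  simpa using hg.clm_comp (-ContinuousLinearMap.id ℝ F)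

theorem sub {k : ℕ} {S : Set (Λ × E)} {g h : Λ → E → F}
    (hg : ContDiffFamilyOn k g S) (hh : ContDiffFamilyOn k h S) :
    ContDiffFamilyOn k (fun l p => g l p - h l p) S := by
  simpa [sub_eq_add_neg] using hg.add hh.neg

theorem comp {k : ℕ} {S : Set (Λ × E)} (hS : IsOpen S) {S' : Set (Λ' × E')} (hS' : IsOpen S')
    {g : Λ → E → F} {u : Λ' → E' → E} {c : Λ' → Λ} (hc : Continuous c)
    (hg : ContDiffFamilyOn k g S) (hu : ContDiffFamilyOn k u S')
    (hm : ∀ z ∈ S', (c z.1, u z.1 z.2) ∈ S) :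
    ContDiffFamilyOn k (fun l p => g (c l) (u l p)) S' := by
  have h0 : ∀ {F : Type} [NormedAddCommGroup F] {g : Λ → E → F},
      ContinuousOn (fun z : Λ × E => g z.1 z.2) S →
      ContinuousOn (fun z : Λ' × E' => g (c z.1) (u z.1 z.2)) S' := fun hg =>
    hg.comp (f := fun z : Λ' × E' => (c z.1, u z.1 z.2))
      ((hc.comp continuous_fst).continuousOn.prodMk hu.continuousOn) hm
  induction k generalizing F with
  | zero => exact (zero_iff hS').2 (h0 hg.continuousOn)
  | succ k ih =>
    have hg' := (succ_iff hS).1 hg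
    have hu' := (succ_iff hS').1 hu
    refine of_fderiv (g' := fun l p => (fderiv ℝ (g (c l)) (u l p)).comp
      (fderiv ℝ (u l) p)) hS' (h0 hg.continuousOn) (fun z hz =>
      (hg'.1 _ (hm z hz)).hasFDerivAt.comp z.2 (hu'.1 z hz).hasFDerivAt) ?_
    exact bilinear hS' (ContinuousLinearMap.compL ℝ E' E F)
      (ih hg'.2.2 (hu.of_le (by omega))) hu'.2.2

theorem comp_univ {k : ℕ} {g : Λ → E → F} {u : Λ' → E' → E} {c : Λ' → Λ} (hc : Continuous c)
    (hg : ContDiffFamilyOn k g univ) (hu : ContDiffFamilyOn k u univ) :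
    ContDiffFamilyOn k (fun l p => g (c l) (u l p)) univ :=
  comp isOpen_univ isOpen_univ hc hg hu fun _ _ => mem_univ _

theorem contDiff_comp {k : ℕ} {φ : F → G} (hφ : ContDiff ℝ k φ) {g : Λ → E → F}
    {S : Set (Λ × E)} (hS : IsOpen S)
    (hg : ContDiffFamilyOn k g S) : ContDiffFamilyOn k (fun l p => φ (g l p)) S :=
  comp (Λ := Λ) isOpen_univ hS continuous_id (of_contDiff hφ) hg fun _ _ => mem_univ _

theorem inv {k : ℕ} {S : Set (Λ × E)} (hS : IsOpen S) {g : Λ → E → ℝ}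
    (hg : ContDiffFamilyOn k g S) (h0 : ∀ z ∈ S, g z.1 z.2 ≠ 0) :
    ContDiffFamilyOn k (fun l p => (g l p)⁻¹) S :=
  comp (Λ := Λ) (isOpen_univ.prod isOpen_compl_singleton) hS continuous_id
    (of_contDiffOn (s := {(0 : ℝ)}ᶜ) isOpen_compl_singleton
      (fun _ hx => (contDiffAt_inv ℝ hx).contDiffWithinAt)) hg fun z hz => ⟨mem_univ _, h0 z hz⟩

theorem div {k : ℕ} {S : Set (Λ × E)} (hS : IsOpen S) {g h : Λ → E → ℝ}
    (hg : ContDiffFamilyOn k g S) (hh : ContDiffFamilyOn k h S) (h0 : ∀ z ∈ S, h z.1 z.2 ≠ 0) :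
    ContDiffFamilyOn k (fun l p => g l p / h l p) S := by
  simpa [div_eq_mul_inv] using mul hS hg (inv hS hh h0)

theorem contDiff {k : ℕ} {g : Λ → E → F} (hg : ContDiffFamilyOn k g univ) (l : Λ) :
    ContDiff ℝ k (g l) :=
  contDiff_iff_contDiffAt.2 fun p => hg.1 (l, p) (mem_univ _)

/-- Compactness of [0, 1] gives one bound for the derivatives near `p`, which serves as the
dominating function. -/
theorem hasFDerivAt_integral {g : Λ × ℝ → E → F} (hg : ContDiffFamilyOn 1 g univ) (l : Λ) (p : E) :
    HasFDerivAt (fun p => ∫ t in (0 : ℝ)..1, g (l, t) p)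
      (∫ t in (0 : ℝ)..1, fderiv ℝ (g (l, t)) p) p := by
  have hg' := (succ_iff isOpen_univ).1 hg
  have hc : Continuous fun z : (Λ × ℝ) × E => fderiv ℝ (g z.1) z.2 := hg'.2.2.continuous
  obtain ⟨C, hC⟩ : ∃ C, ∀ t ∈ Icc (0 : ℝ) 1, ‖fderiv ℝ (g (l, t)) p‖ ≤ C :=
    isCompact_Icc.exists_bound_of_continuousOn
      (hc.comp (f := fun t => ((l, t), p)) (by fun_prop)).continuousOn
  have hev : ∀ᶠ q in 𝓝 p, ∀ t ∈ Icc (0 : ℝ) 1, ‖fderiv ℝ (g (l, t)) q‖ < C + 1 := by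
    refine isCompact_Icc.eventually_forall_of_forall_eventually fun t ht => ?_
    have : Continuous fun z : E × ℝ => ‖fderiv ℝ (g (l, z.2)) z.1‖ :=
      (hc.comp (f := fun z : E × ℝ => ((l, z.2), z.1)) (by fun_prop)).norm
    exact this.continuousAt.eventually_lt continuousAt_const
      (show ‖fderiv ℝ (g (l, t)) p‖ < C + 1 from (hC t ht).trans_lt (lt_add_one C))
  refine intervalIntegral.hasFDerivAt_integral_of_dominated_of_fderiv_le (F := fun q t => g (l, t) q)
    (F' := fun q t => fderiv ℝ (g (l, t)) q) (bound := fun _ => C + 1) hev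
    (Eventually.of_forall fun q => ?_) ?_ ?_ ?_ ?_ ?_
  · exact Continuous.aestronglyMeasurable
      (hg.continuous.comp (f := fun t : ℝ => ((l, t), q)) (by fun_prop))
  · exact Continuous.intervalIntegrable
      (hg.continuous.comp (f := fun t : ℝ => ((l, t), p)) (by fun_prop)) _ _
  · exact Continuous.aestronglyMeasurable
      (hc.comp (f := fun t : ℝ => ((l, t), p)) (by fun_prop))
  · refine Eventually.of_forall fun t ht q hq => (hq t ?_).le
    rw [uIoc_of_le zero_le_one] at ht
    exact Ioc_subset_Icc_self ht
  · exact intervalIntegrable_const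
  · exact Eventually.of_forall fun t _ q _ => (hg'.1 ((l, t), q) (mem_univ _)).hasFDerivAt

/-- The integration variable is counted among the parameters, so that joint continuity in it is part
of the hypothesis. -/
theorem integral {k : ℕ} {g : Λ × ℝ → E → F} (hg : ContDiffFamilyOn k g univ) :
    ContDiffFamilyOn k (fun (l : Λ) p => ∫ t in (0 : ℝ)..1, g (l, t) p) univ := by
  have h0 : Continuous (fun z : Λ × E => ∫ t in (0 : ℝ)..1, g (z.1, t) z.2) := by
    refine intervalIntegral.continuous_parametric_intervalIntegral_of_continuous'
      (f := fun (z : Λ × E) t => g (z.1, t) z.2) ?_ 0 1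
    exact hg.continuous.comp (f := fun w : (Λ × E) × ℝ => ((w.1.1, w.2), w.1.2)) (by fun_prop)
  induction k generalizing F with
  | zero => exact (zero_iff isOpen_univ).2 h0.continuousOn
  | succ k ih =>
    have hg' := (succ_iff isOpen_univ).1 hg
    refine of_fderiv isOpen_univ h0.continuousOn
      (fun z _ => hasFDerivAt_integral (hg.of_le (by omega)) z.1 z.2) (ih hg'.2.2 ?_)
    refine intervalIntegral.continuous_parametric_intervalIntegral_of_continuous'
      (f := fun (z : Λ × E) t => fderiv ℝ (g (z.1, t)) z.2) ?_ 0 1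
    exact hg'.2.2.continuous.comp
      (f := fun w : (Λ × E) × ℝ => ((w.1.1, w.2), w.1.2)) (by fun_prop)

theorem continuous_iteratedDeriv {k : ℕ} {g : Λ → ℝ → F} (hg : ContDiffFamilyOn k g univ) {j : ℕ}
    (hj : j ≤ k) : Continuous fun z : Λ × ℝ => iteratedDeriv j (g z.1) z.2 := by
  have := (ContinuousMultilinearMap.apply ℝ (fun _ : Fin j => ℝ) F
    (fun _ => 1)).continuous.comp (continuousOn_univ.1 (hg.2 j hj))
  exact this

end ContDiffFamilyOn

end Families

/-! ### Global flows of Lipschitz equations and continuous dependence. -/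

section Flows

open scoped NNReal

variable {Λ : Type*} [TopologicalSpace Λ] {E : Type*} [NormedAddCommGroup E] [NormedSpace ℝ E]

/-- Solutions of a globally Lipschitz equation are determined by one value. -/
theorem eq_of_hasDerivAt_of_lipschitzWith {v : ℝ → E → E} {K : ℝ≥0} (hv : ∀ t, LipschitzWith K (v t))
    {f g : ℝ → E} (hf : ∀ t, HasDerivAt f (v t (f t)) t) (hg : ∀ t, HasDerivAt g (v t (g t)) t)
    {t₀ : ℝ} (h : f t₀ = g t₀) : f = g :=
  ODE_solution_unique_univ (s := fun _ => univ) (fun t => (hv t).lipschitzOnWith)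
    (fun t => ⟨hf t, mem_univ _⟩) (fun t => ⟨hg t, mem_univ _⟩) h

/-- A bounded, globally Lipschitz equation has global solutions. -/
theorem exists_forall_hasDerivAt_of_lipschitzWith [CompleteSpace E] {v : ℝ → E → E} {K : ℝ≥0}
    {B : ℝ} (hc : ∀ z, Continuous fun t => v t z) (hv : ∀ t, LipschitzWith K (v t))
    (hB : ∀ t z, ‖v t z‖ ≤ B) (t₀ : ℝ) (z : E) :
    ∃ α : ℝ → E, α t₀ = z ∧ ∀ t, HasDerivAt α (v t (α t)) t := by
  have hB0 : 0 ≤ B := (norm_nonneg _).trans (hB 0 0)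
  have hex : ∀ N : ℕ, ∃ α : ℝ → E, α t₀ = z ∧
      ∀ t ∈ Ioo (t₀ - N) (t₀ + N), HasDerivAt α (v t (α t)) t := by
    intro N
    have hN : (0 : ℝ) ≤ N := N.cast_nonneg
    -- Speed at most B keeps a solution within distance B·N of `z` during time N, so this radius
    -- imposes no restriction on the time.
    have hP : IsPicardLindelof v (tmin := t₀ - N) (tmax := t₀ + N)
        ⟨t₀, by constructor <;> linarith⟩ z (B.toNNReal * N) 0 B.toNNReal K :=
      { lipschitzOnWith := fun t _ => (hv t).lipschitzOnWith
        continuousOn := fun x _ => (hc x).continuousOn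
        norm_le := fun t _ x _ => by rw [Real.coe_toNNReal _ hB0]; exact hB t x
        mul_max_le := by simp }
    obtain ⟨α, h1, h2⟩ := hP.exists_eq_forall_mem_Icc_hasDerivWithinAt₀
    exact ⟨α, h1, fun t ht => (h2 t (Ioo_subset_Icc_self ht)).hasDerivAt (Icc_mem_nhds ht.1 ht.2)⟩
  choose α h1 h2 using hex
  have hag : ∀ M N : ℕ, M ≤ N → ∀ t, |t - t₀| < M → α M t = α N t := by
    intro M N hMN t ht
    have hMN' : (M : ℝ) ≤ N := by exact_mod_cast hMN
    rw [abs_lt] at ht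
    have := ODE_solution_unique_of_mem_Ioo (v := v) (s := fun _ => univ) (K := K)
      (a := t₀ - M) (b := t₀ + M) (t₀ := t₀) (f := α M) (g := α N)
      (fun t _ => (hv t).lipschitzOnWith) ⟨by linarith, by linarith⟩
      (fun t ht => ⟨h2 M t ht, mem_univ _⟩)
      (fun t ht => ⟨h2 N t ⟨by linarith [ht.1], by linarith [ht.2]⟩, mem_univ _⟩)
      (by rw [h1, h1])
    exact this ⟨by linarith, by linarith⟩
  have hval : ∀ (N : ℕ) t, |t - t₀| < N → α (⌈|t - t₀|⌉₊ + 1) t = α N t := by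
    intro N t ht
    have h3 : |t - t₀| < ((⌈|t - t₀|⌉₊ + 1 : ℕ) : ℝ) := by
      push_cast
      linarith [Nat.le_ceil |t - t₀|]
    rcases le_total N (⌈|t - t₀|⌉₊ + 1) with h | h
    · exact (hag _ _ h t ht).symm
    · exact hag _ _ h t h3
  -- The local solutions agree on overlaps. The summand 1 in the index puts `t` strictly inside the
  -- interval of the solution used there.
  refine ⟨fun t => α (⌈|t - t₀|⌉₊ + 1) t, by simp [h1], fun t => ?_⟩
  obtain ⟨N, hN⟩ := exists_nat_gt |t - t₀|
  have hev : (fun t => α (⌈|t - t₀|⌉₊ + 1) t) =ᶠ[𝓝 t] α N := by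
    have : ∀ᶠ s in 𝓝 t, |s - t₀| < N :=
      (continuous_id.sub continuous_const).abs.continuousAt.eventually_lt continuousAt_const hN
    filter_upwards [this] with s hs using hval N s hs
  have h4 := abs_lt.1 hN
  have := (h2 N t ⟨by linarith, by linarith⟩).congr_of_eventuallyEq hev
  rwa [← hval N t hN] at this

/-- With initial error and defect both equal to `a`, the Grönwall bound is linear in `a`, hence
tends to 0 with it. -/
theorem gronwallBound_self_mul (a : ℝ) (K x : ℝ) :
    gronwallBound a K a x = a * gronwallBound 1 K 1 x := by
  unfold gronwallBound
  split_ifs <;> ring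

/-- Continuous dependence of solutions on a parameter. -/
theorem continuousAt_solution {v : Λ → ℝ → E → E} {u : Λ → ℝ → E} {l₀ : Λ} {K : ℝ≥0}
    (hc : Continuous fun z : Λ × ℝ × E => v z.1 z.2.1 z.2.2)
    (hv : ∀ᶠ l in 𝓝 l₀, ∀ t, LipschitzWith K (v l t))
    (hu : ∀ l t, HasDerivAt (u l) (v l t (u l t)) t)
    (h0 : ContinuousAt (fun l => u l 0) l₀) : ContinuousAt (fun l => u l 1) l₀ := by
  have hcu : ∀ l, Continuous (u l) := fun l =>
    continuous_iff_continuousAt.2 fun t => (hu l t).continuousAt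
  have key : ∀ a > 0, ∀ᶠ l in 𝓝 l₀, dist (u l 1) (u l₀ 1) ≤ a * gronwallBound 1 K 1 1 := by
    intro a ha
    have h1 : ∀ᶠ l in 𝓝 l₀, ∀ t ∈ Icc (0 : ℝ) 1,
        dist (v l t (u l₀ t)) (v l₀ t (u l₀ t)) < a := by
      refine isCompact_Icc.eventually_forall_of_forall_eventually fun t _ => ?_
      have h2 : Continuous fun z : Λ × ℝ => dist (v z.1 z.2 (u l₀ z.2)) (v l₀ z.2 (u l₀ z.2)) := by
        have hc1 : Continuous fun z : Λ × ℝ => v z.1 z.2 (u l₀ z.2) :=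
          hc.comp (f := fun z : Λ × ℝ => (z.1, z.2, u l₀ z.2)) (by fun_prop)
        have hc2 : Continuous fun z : Λ × ℝ => v l₀ z.2 (u l₀ z.2) :=
          hc.comp (f := fun z : Λ × ℝ => (l₀, z.2, u l₀ z.2)) (by fun_prop)
        exact hc1.dist hc2
      exact h2.continuousAt.eventually_lt continuousAt_const (by simpa using ha)
    have h3 : ∀ᶠ l in 𝓝 l₀, dist (u l 0) (u l₀ 0) < a := by
      have := Metric.continuousAt_iff'.1 h0 a ha
      exact this
    filter_upwards [h1, h3, hv] with l hl1 hl3 hl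
    rw [← gronwallBound_self_mul]
    -- `u l₀` is regarded as an approximate solution of the equation with parameter `l`, with defect
    -- at most `a` on [0, 1].
    have := dist_le_of_approx_trajectories_ODE (v := v l) (K := K) (f := u l) (g := u l₀)
      (f' := fun t => v l t (u l t)) (g' := fun t => v l₀ t (u l₀ t)) (a := 0) (b := 1)
      (εf := 0) (εg := a) (δ := a) hl (hcu l).continuousOn
      (fun t _ => (hu l t).hasDerivWithinAt) (fun t _ => by simp) (hcu l₀).continuousOn
      (fun t _ => (hu l₀ t).hasDerivWithinAt)
      (fun t ht => by rw [dist_comm]; exact (hl1 t (Ico_subset_Icc_self ht)).le) hl3.le 1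
      (by simp)
    simpa using this
  rw [Metric.continuousAt_iff']
  intro ε hε
  set C := gronwallBound 1 K 1 1
  have hC : 0 < |C| + 1 := by positivity
  filter_upwards [key (ε / (|C| + 1)) (by positivity)] with l hl
  refine hl.trans_lt ?_
  calc ε / (|C| + 1) * C ≤ ε / (|C| + 1) * |C| := by gcongr; exact le_abs_self C
    _ < ε / (|C| + 1) * (|C| + 1) := by gcongr; linarith
    _ = ε := by field_simp

/-- Global flow of a family of bounded, locally uniformly Lipschitz equations, with continuous
dependence on parameter, time and initial value. -/
theorem exists_continuous_flow [CompleteSpace E] {v : Λ → ℝ → E → E}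
    (hc : Continuous fun z : Λ × ℝ × E => v z.1 z.2.1 z.2.2)
    (hv : ∀ l₀, ∃ K : ℝ≥0, ∀ᶠ l in 𝓝 l₀, ∀ t, LipschitzWith K (v l t))
    (hB : ∀ l, ∃ B, ∀ t z, ‖v l t z‖ ≤ B) (t₀ : ℝ) :
    ∃ φ : Λ → ℝ → E → E, (∀ l z, φ l t₀ z = z) ∧
      (∀ l z t, HasDerivAt (fun t => φ l t z) (v l t (φ l t z)) t) ∧
      Continuous fun z : Λ × ℝ × E => φ z.1 z.2.1 z.2.2 := by
  have hex : ∀ l z, ∃ α : ℝ → E, α t₀ = z ∧ ∀ t, HasDerivAt α (v l t (α t)) t := by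
    intro l z
    obtain ⟨K, hK⟩ := hv l
    obtain ⟨B, hB⟩ := hB l
    exact exists_forall_hasDerivAt_of_lipschitzWith (fun z => hc.comp
      (f := fun t : ℝ => (l, t, z)) (by fun_prop)) hK.self_of_nhds hB t₀ z
  choose φ h1 h2 using hex
  refine ⟨fun l t z => φ l z t, h1, h2, continuous_iff_continuousAt.2 fun ⟨l₀, t₁, z₁⟩ => ?_⟩
  obtain ⟨K, hK⟩ := hv l₀
  -- Rescaling time so that the solution runs from s = 0 to s = 1 makes the final time and the
  -- initial value into additional parameters.
  have := continuousAt_solution (Λ := Λ × ℝ × E) (l₀ := (l₀, t₁, z₁))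
    (v := fun p s w => (p.2.1 - t₀) • v p.1 (t₀ + s * (p.2.1 - t₀)) w)
    (u := fun p s => φ p.1 p.2.2 (t₀ + s * (p.2.1 - t₀))) (K := (|t₁ - t₀| + 1).toNNReal * K)
    ?_ ?_ ?_ ?_
  · simpa using this
  · have : Continuous fun z : (Λ × ℝ × E) × ℝ × E =>
        v z.1.1 (t₀ + z.2.1 * (z.1.2.1 - t₀)) z.2.2 :=
      hc.comp (f := fun z : (Λ × ℝ × E) × ℝ × E => (z.1.1, t₀ + z.2.1 * (z.1.2.1 - t₀), z.2.2))
        (by fun_prop)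
    fun_prop
  · have h3 : ∀ᶠ p in 𝓝 (l₀, t₁, z₁), ∀ t, LipschitzWith K (v p.1 t) :=
      (continuous_fst.tendsto (l₀, t₁, z₁)).eventually hK
    have h4 : ∀ᶠ p : Λ × ℝ × E in 𝓝 (l₀, t₁, z₁), |p.2.1 - t₀| < |t₁ - t₀| + 1 :=
      ContinuousAt.eventually_lt (f := fun p : Λ × ℝ × E => |p.2.1 - t₀|)
        (by fun_prop) continuousAt_const (lt_add_one _)
    filter_upwards [h3, h4] with p hp3 hp4 t
    refine LipschitzWith.of_dist_le_mul fun x y => ?_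
    rw [dist_smul₀, NNReal.coe_mul, Real.coe_toNNReal _ (by positivity), mul_assoc]
    exact mul_le_mul hp4.le ((hp3 _).dist_le_mul _ _) dist_nonneg (by positivity)
  · intro p s
    have h5 : HasDerivAt (fun s : ℝ => t₀ + s * (p.2.1 - t₀)) (p.2.1 - t₀) s := by
      simpa using ((hasDerivAt_id s).mul_const (p.2.1 - t₀)).const_add t₀
    exact (h2 p.1 p.2.2 _).scomp s h5
  · simp only [zero_mul, add_zero, h1]
    fun_prop

end Flows

/-! ### Locally uniform Lipschitz constants. -/

section FamilyLipschitz

open scoped NNReal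

variable {Λ : Type*} [TopologicalSpace Λ] {E F : Type}
  [NormedAddCommGroup E] [NormedSpace ℝ E] [NormedAddCommGroup F] [NormedSpace ℝ F]

theorem ContDiffFamilyOn.exists_eventually_lipschitzWith {g : Λ → E → F}
    (hg : ContDiffFamilyOn 1 g univ) {K : Set E} (hK : IsCompact K)
    (h0 : ∀ l, ∀ p ∉ K, fderiv ℝ (g l) p = 0) (l₀ : Λ) :
    ∃ C : ℝ≥0, ∀ᶠ l in 𝓝 l₀, LipschitzWith C (g l) := by
  have hg' := (succ_iff (k := 0) isOpen_univ).1 hg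
  have hc : Continuous fun z : Λ × E => fderiv ℝ (g z.1) z.2 := hg'.2.2.continuous
  obtain ⟨C, hC⟩ : ∃ C, ∀ p ∈ K, ‖fderiv ℝ (g l₀) p‖ ≤ C :=
    hK.exists_bound_of_continuousOn
      (hc.comp (f := fun p => (l₀, p)) (by fun_prop)).continuousOn
  have hev : ∀ᶠ l in 𝓝 l₀, ∀ p ∈ K, ‖fderiv ℝ (g l) p‖ < C + 1 :=
    hK.eventually_forall_of_forall_eventually fun p hp =>
      hc.norm.continuousAt.eventually_lt continuousAt_const ((hC p hp).trans_lt (lt_add_one C))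
  refine ⟨(C + 1).toNNReal, ?_⟩
  filter_upwards [hev] with l hl
  refine lipschitzWith_of_nnnorm_fderiv_le (fun p => hg'.1 (l, p) (mem_univ _)) fun p => ?_
  by_cases hp : p ∈ K
  · rw [← NNReal.coe_le_coe]
    exact (hl p hp).le.trans (Real.le_coe_toNNReal _)
  · simp [h0 l p hp]

end FamilyLipschitz

/-! ### The scalar equation for orbits as graphs. -/

section GraphFlow

open scoped NNReal

/-- Carathéodory's form of differentiability. It yields the derivatives in the initial value and of
the zero function `T` directly from exact difference quotients. -/
theorem hasDerivAt_of_sub_eq_mul {g E : ℝ → ℝ} {b : ℝ} (hE : ContinuousAt E b)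
    (h : ∀ b', g b' - g b = (b' - b) * E b') : HasDerivAt g (E b) b := by
  rw [hasDerivAt_iff_tendsto_slope]
  refine (hE.tendsto.mono_left nhdsWithin_le_nhds).congr' ?_
  filter_upwards [self_mem_nhdsWithin] with b' hb'
  have : b' - b ≠ 0 := sub_ne_zero.2 hb'
  rw [slope_def_field, h]
  field_simp

variable {Λ : Type*} [TopologicalSpace Λ]

/-- The solutions `y l (·, b)` of `dy/dx = f l (x, y)`, `y x₀ = b`, together with their difference
quotients `e` in the initial value, and the initial value `T l x` of the solution which vanishes
at `x`. -/
structure IsGraphFlow (f : Λ → ℝ × ℝ → ℝ) (x₀ : ℝ) (m : ℕ) (y : Λ → ℝ × ℝ → ℝ)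
    (e : Λ → ℝ → ℝ → ℝ → ℝ) (T : Λ → ℝ → ℝ) : Prop where
  lipschitz : ∀ l, ∃ K : ℝ≥0, LipschitzWith K (f l)
  init : ∀ l b, y l (x₀, b) = b
  hasDerivAt : ∀ l b x, HasDerivAt (fun x => y l (x, b)) (f l (x, y l (x, b))) x
  contDiff : ContDiffFamilyOn (m + 1) y univ
  continuous_quot : Continuous fun z : Λ × ℝ × ℝ × ℝ => e z.1 z.2.1 z.2.2.1 z.2.2.2
  quot_pos : ∀ l x b b', 0 < e l x b b'
  sub_eq : ∀ l x b b', y l (x, b') - y l (x, b) = (b' - b) * e l x b b'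
  zero : ∀ l x, y l (x, T l x) = 0
  contDiff_zero : ContDiffFamilyOn (m + 1) T univ

theorem IsGraphFlow.eq_of_hasDerivAt {f : Λ → ℝ × ℝ → ℝ} {x₀ : ℝ} {m : ℕ} {y : Λ → ℝ × ℝ → ℝ}
    {e : Λ → ℝ → ℝ → ℝ → ℝ} {T : Λ → ℝ → ℝ} (h : IsGraphFlow f x₀ m y e T) (l : Λ) {z : ℝ → ℝ}
    (hz : ∀ x, HasDerivAt z (f l (x, z x)) x) (x : ℝ) : z x = y l (x, z x₀) := by
  obtain ⟨K, hK⟩ := h.lipschitz l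
  have := eq_of_hasDerivAt_of_lipschitzWith (v := fun x y => f l (x, y)) (K := K * 1)
    (fun t => hK.comp (LipschitzWith.prodMk_left t)) hz (fun x => h.hasDerivAt l (z x₀) x)
    (t₀ := x₀) (h.init l _).symm
  exact congrFun this x

/-- A compactly supported family of equations of class `C^(m+1)` has a graph flow. -/
theorem exists_isGraphFlow {f : Λ → ℝ × ℝ → ℝ} {m : ℕ} (hf : ContDiffFamilyOn (m + 1) f univ)
    {K : Set (ℝ × ℝ)} (hK : IsCompact K) (h0 : ∀ l, ∀ p ∉ K, f l p = 0) (x₀ : ℝ) :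
    ∃ y e T, IsGraphFlow f x₀ m y e T := by
  have hfc := hf.continuous
  have hfd := (ContDiffFamilyOn.succ_iff isOpen_univ).1 hf
  have hlip := (hf.of_le (l := 1) (by omega)).exists_eventually_lipschitzWith hK
    (fun l p hp => by
      have : f l =ᶠ[𝓝 p] fun _ => 0 := by
        filter_upwards [hK.isClosed.isOpen_compl.mem_nhds hp] with q hq using h0 l q hq
      simpa using this.fderiv_eq)
  have hbd : ∀ l, ∃ B, ∀ p, ‖f l p‖ ≤ B := by
    intro l
    obtain ⟨B, hB⟩ := hK.exists_bound_of_continuousOn (f := f l)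
      (hfc.comp (f := fun p => (l, p)) (by fun_prop)).continuousOn
    refine ⟨max B 0, fun p => ?_⟩
    by_cases hp : p ∈ K
    · exact (hB p hp).trans (le_max_left _ _)
    · simp [h0 l p hp]
  obtain ⟨φ, hφ0, hφd, hφc⟩ := exists_continuous_flow (Λ := Λ) (E := ℝ)
    (v := fun l x y => f l (x, y))
    (hfc.comp (f := fun z : Λ × ℝ × ℝ => (z.1, (z.2.1, z.2.2))) (by fun_prop))
    (fun l₀ => (hlip l₀).imp fun C hC => hC.mono fun l hl t => by
      simpa [Function.comp_def] using hl.comp (LipschitzWith.prodMk_left t))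
    (fun l => (hbd l).imp fun B hB t z => hB _) x₀
  set y : Λ → ℝ × ℝ → ℝ := fun l p => φ l p.1 p.2 with hy
  have hyc : Continuous fun z : Λ × ℝ × ℝ => y z.1 z.2 := hφc
  have hyd : ∀ l b x, HasDerivAt (fun x => y l (x, b)) (f l (x, y l (x, b))) x :=
    fun l b x => hφd l b x
  -- the partial derivative in the second variable
  set fy : Λ → ℝ × ℝ → ℝ := fun l p => fderiv ℝ (f l) p (0, 1) with hfy
  have hfyF : ContDiffFamilyOn m fy univ :=
    hfd.2.2.clm_comp (ContinuousLinearMap.apply ℝ ℝ ((0 : ℝ), (1 : ℝ)))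
  have hfyc := hfyF.continuous
  have hfyd : ∀ l s z, HasDerivAt (fun z => f l (s, z)) (fy l (s, z)) z := by
    intro l s z
    have h1 : HasDerivAt (fun z : ℝ => (s, z)) ((0 : ℝ), (1 : ℝ)) z :=
      (hasDerivAt_const z s).prodMk (hasDerivAt_id z)
    exact (hfd.1 (l, (s, z)) (mem_univ _)).hasFDerivAt.comp_hasDerivAt z h1
  -- Hadamard's lemma: `A` is the mean of the partial derivative over the segment from `z` to `z'`,
  -- and is thus a difference quotient continuous also on the diagonal.
  set A : Λ → ℝ → ℝ → ℝ → ℝ := fun l s z z' => ∫ τ in (0 : ℝ)..1, fy l (s, z + τ * (z' - z))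
    with hA
  have hAc : Continuous fun w : Λ × ℝ × ℝ × ℝ => A w.1 w.2.1 w.2.2.1 w.2.2.2 := by
    refine intervalIntegral.continuous_parametric_intervalIntegral_of_continuous'
      (f := fun (w : Λ × ℝ × ℝ × ℝ) τ => fy w.1 (w.2.1, w.2.2.1 + τ * (w.2.2.2 - w.2.2.1))) ?_ 0 1
    exact hfyc.comp (f := fun v : (Λ × ℝ × ℝ × ℝ) × ℝ =>
      (v.1.1, (v.1.2.1, v.1.2.2.1 + v.2 * (v.1.2.2.2 - v.1.2.2.1)))) (by fun_prop)
  have hAsub : ∀ l s z z', f l (s, z') - f l (s, z) = A l s z z' * (z' - z) := by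
    intro l s z z'
    have h1 : ∀ τ ∈ uIcc (0 : ℝ) 1, HasDerivAt (fun τ => f l (s, z + τ * (z' - z)))
        (fy l (s, z + τ * (z' - z)) * (z' - z)) τ := by
      intro τ _
      have h2 : HasDerivAt (fun τ : ℝ => z + τ * (z' - z)) (z' - z) τ := by
        simpa using ((hasDerivAt_id τ).mul_const (z' - z)).const_add z
      exact (hfyd l s _).comp τ h2
    have h3 := intervalIntegral.integral_eq_sub_of_hasDerivAt h1 (by
      refine Continuous.intervalIntegrable ?_ _ _
      exact (hfyc.comp (f := fun τ : ℝ => (l, (s, z + τ * (z' - z)))) (by fun_prop)).mul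
        continuous_const)
    rw [intervalIntegral.integral_mul_const] at h3
    rw [hA]
    simp only at h3 ⊢
    rw [h3]
    simp
  set a : Λ → ℝ → ℝ → ℝ → ℝ := fun l s b b' => A l s (y l (s, b)) (y l (s, b')) with ha
  have hac : Continuous fun w : Λ × ℝ × ℝ × ℝ => a w.1 w.2.1 w.2.2.1 w.2.2.2 := by
    refine hAc.comp (f := fun w : Λ × ℝ × ℝ × ℝ =>
      (w.1, w.2.1, y w.1 (w.2.1, w.2.2.1), y w.1 (w.2.1, w.2.2.2))) ?_
    have h1 := hyc.comp (f := fun w : Λ × ℝ × ℝ × ℝ => (w.1, (w.2.1, w.2.2.1))) (by fun_prop)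
    have h2 := hyc.comp (f := fun w : Λ × ℝ × ℝ × ℝ => (w.1, (w.2.1, w.2.2.2))) (by fun_prop)
    exact continuous_fst.prodMk ((continuous_fst.comp continuous_snd).prodMk (h1.prodMk h2))
  -- The difference of two solutions satisfies the linear equation w' = a w; `e` is the
  -- corresponding exponential factor, positive by construction.
  set e : Λ → ℝ → ℝ → ℝ → ℝ := fun l x b b' => Real.exp (∫ s in x₀..x, a l s b b') with he
  have hec : Continuous fun z : Λ × ℝ × ℝ × ℝ => e z.1 z.2.1 z.2.2.1 z.2.2.2 := by
    refine Real.continuous_exp.comp ?_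
    refine intervalIntegral.continuous_parametric_intervalIntegral_of_continuous
      (f := fun (w : Λ × ℝ × ℝ × ℝ) s => a w.1 s w.2.2.1 w.2.2.2) ?_ (by fun_prop)
    exact hac.comp (f := fun v : (Λ × ℝ × ℝ × ℝ) × ℝ => (v.1.1, v.2, v.1.2.2.1, v.1.2.2.2))
      (by fun_prop)
  have hsub : ∀ l x b b', y l (x, b') - y l (x, b) = (b' - b) * e l x b b' := by
    intro l x b b'
    have h1 : ∀ x, HasDerivAt (fun x => ∫ s in x₀..x, a l s b b') (a l x b b') x := by
      intro x
      have hc : Continuous fun s => a l s b b' :=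
        hac.comp (f := fun s => (l, s, b, b')) (by fun_prop)
      exact intervalIntegral.integral_hasDerivAt_right (hc.intervalIntegrable _ _)
        (hc.stronglyMeasurableAtFilter _ _) hc.continuousAt
    have h2 : ∀ x, HasDerivAt (fun x => (y l (x, b') - y l (x, b)) *
        Real.exp (-∫ s in x₀..x, a l s b b')) 0 x := by
      intro x
      have h3 := ((hyd l b' x).sub (hyd l b x)).mul (h1 x).neg.exp
      refine h3.congr_deriv ?_
      rw [hAsub]
      simp only [ha]
      simp only [Pi.sub_apply]
      ring
    have h4 := is_const_of_deriv_eq_zero (fun x => (h2 x).differentiableAt)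
      (fun x => (h2 x).deriv) x x₀
    simp only [intervalIntegral.integral_same, neg_zero, Real.exp_zero, mul_one] at h4
    have h5 : y l (x₀, b') - y l (x₀, b) = b' - b := by simp [hy, hφ0]
    rw [h5, Real.exp_neg] at h4
    rw [← h4, he]
    field_simp
  have hyb : ∀ l x b, HasDerivAt (fun b => y l (x, b)) (e l x b b) b := fun l x b =>
    hasDerivAt_of_sub_eq_mul (E := fun b' => e l x b b')
      (hec.comp (f := fun b' => (l, x, b, b')) (by fun_prop)).continuousAt (hsub l x b)
  set L1 : ℝ →L[ℝ] (ℝ × ℝ →L[ℝ] ℝ) :=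
    (ContinuousLinearMap.id ℝ ℝ).smulRight (ContinuousLinearMap.fst ℝ ℝ ℝ) with hL1
  set L2 : ℝ →L[ℝ] (ℝ × ℝ →L[ℝ] ℝ) :=
    (ContinuousLinearMap.id ℝ ℝ).smulRight (ContinuousLinearMap.snd ℝ ℝ ℝ) with hL2
  set yb : Λ → ℝ × ℝ → ℝ := fun l p => e l p.1 p.2 p.2 with hybdef
  have hfyc' : Continuous fun z : Λ × ℝ × ℝ => f z.1 (z.2.1, y z.1 z.2) :=
    hfc.comp (f := fun z : Λ × ℝ × ℝ => (z.1, (z.2.1, y z.1 z.2))) (by fun_prop)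
  have hybc : Continuous fun z : Λ × ℝ × ℝ => yb z.1 z.2 :=
    hec.comp (f := fun z : Λ × ℝ × ℝ => (z.1, z.2.1, z.2.2, z.2.2)) (by fun_prop)
  have hyF : ∀ l p, HasFDerivAt (y l) (L1 (f l (p.1, y l p)) + L2 (yb l p)) p := by
    intro l p
    have h1 := hasStrictFDerivAt_uncurry_coprod (𝕜 := ℝ) (u := p)
      (f := fun x b => y l (x, b))
      (f₁ := fun x b => ContinuousLinearMap.toSpanSingleton ℝ (f l (x, y l (x, b))))
      (f₂ := fun x b => ContinuousLinearMap.toSpanSingleton ℝ (yb l (x, b)))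
      (Eventually.of_forall fun v => (hyd l v.2 v.1).hasFDerivAt)
      (Eventually.of_forall fun v => (hyb l v.1 v.2).hasFDerivAt) ?_ ?_
    · refine h1.hasFDerivAt.congr_fderiv ?_
      ext <;> simp [hL1, hL2, Function.HasUncurry.uncurry]
    · refine Continuous.continuousAt ?_
      exact (ContinuousLinearMap.toSpanSingletonCLE (𝕜 := ℝ) (E := ℝ)).continuous.comp
        (hfyc'.comp (f := fun p => (l, p)) (by fun_prop))
    · refine Continuous.continuousAt ?_
      exact (ContinuousLinearMap.toSpanSingletonCLE (𝕜 := ℝ) (E := ℝ)).continuous.comp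
        (hybc.comp (f := fun p => (l, p)) (by fun_prop))
  -- On the diagonal b' = b the mean in `A` is trivial; rescaling the remaining integral to [0, 1]
  -- brings it into the form of `ContDiffFamilyOn.integral`.
  have hybrep : ∀ l p, yb l p = Real.exp ((p.1 - x₀) * ∫ τ in (0 : ℝ)..1,
      fy l (x₀ + τ * (p.1 - x₀), y l (x₀ + τ * (p.1 - x₀), p.2))) := by
    intro l p
    have h1 := intervalIntegral.mul_integral_comp_add_mul (a := 0) (b := 1)
      (f := fun s => fy l (s, y l (s, p.2))) (p.1 - x₀) x₀
    simp only [mul_zero, add_zero, mul_one, add_sub_cancel] at h1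
    simp only [hybdef, he, ha, hA, sub_self, mul_zero, add_zero, intervalIntegral.integral_const,
      sub_zero, one_smul]
    rw [← h1]
    simp only [mul_comm]
  have hybF : ∀ k ≤ m, ContDiffFamilyOn k y univ → ContDiffFamilyOn k yb univ := by
    intro k hk hyk
    have h1 : ContDiffFamilyOn k (fun (w : Λ × ℝ) (p : ℝ × ℝ) => x₀ + w.2 * (p.1 - x₀)) univ :=
      (ContDiffFamilyOn.of_contDiff contDiff_const).add
        (ContDiffFamilyOn.mul isOpen_univ (ContDiffFamilyOn.of_continuous_param continuous_snd)
          (ContDiffFamilyOn.of_contDiff (contDiff_fst.sub contDiff_const)))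
    have h2 : ContDiffFamilyOn k (fun (w : Λ × ℝ) (p : ℝ × ℝ) =>
        y w.1 (x₀ + w.2 * (p.1 - x₀), p.2)) univ :=
      ContDiffFamilyOn.comp_univ continuous_fst hyk
        (h1.prodMk (ContDiffFamilyOn.of_contDiff contDiff_snd))
    have h3 : ContDiffFamilyOn k (fun (w : Λ × ℝ) (p : ℝ × ℝ) =>
        fy w.1 (x₀ + w.2 * (p.1 - x₀), y w.1 (x₀ + w.2 * (p.1 - x₀), p.2))) univ :=
      ContDiffFamilyOn.comp_univ continuous_fst (hfyF.of_le hk) (h1.prodMk h2)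
    have h4 := h3.integral
    refine ((ContDiffFamilyOn.mul isOpen_univ (ContDiffFamilyOn.of_contDiff
      (contDiff_fst.sub (contDiff_const (c := x₀)))) h4).contDiff_comp (φ := Real.exp) Real.contDiff_exp
        isOpen_univ).congr isOpen_univ fun z _ => ?_
    exact hybrep z.1 z.2
  -- Bootstrap: if `y` is of class C^k, then so are both of its partial derivatives, and `y` is of
  -- class C^(k+1). The gain ends at m + 1 because `fy` is only of class C^m.
  have hyk : ∀ k ≤ m + 1, ContDiffFamilyOn k y univ := by
    intro k
    induction k with
    | zero => exact fun _ => (ContDiffFamilyOn.zero_iff isOpen_univ).2 hyc.continuousOn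
    | succ k ih =>
      intro hk
      have hk' := ih (by omega)
      refine ContDiffFamilyOn.of_fderiv
        (g' := fun l p => L1 (f l (p.1, y l p)) + L2 (yb l p)) isOpen_univ hyc.continuousOn
        (fun z _ => hyF z.1 z.2) (ContDiffFamilyOn.add ?_ ?_)
      · exact (ContDiffFamilyOn.comp_univ continuous_id (hf.of_le (by omega))
          ((ContDiffFamilyOn.of_contDiff contDiff_fst).prodMk hk')).clm_comp L1
      · exact (hybF k (by omega) hk').clm_comp L2
  -- the initial value of the solution vanishing at a given point
  have hexT : ∀ l x, ∃ b, y l (x, b) = 0 := by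
    intro l x
    obtain ⟨C, hC⟩ := hlip l
    obtain ⟨B, hB⟩ := hbd l
    have hLip : ∀ t, LipschitzWith C fun z => f l (t, z) := fun t => by
      simpa [Function.comp_def] using hC.self_of_nhds.comp (LipschitzWith.prodMk_left t)
    -- The solution through the point (x, 0) is followed to the line at `x₀`; its value there is the
    -- required initial value.
    obtain ⟨u, hu0, hu⟩ := exists_forall_hasDerivAt_of_lipschitzWith (E := ℝ)
      (v := fun x y => f l (x, y)) (fun z => hfc.comp (f := fun t => (l, (t, z))) (by fun_prop))
      hLip (fun t z => hB _) x 0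
    refine ⟨u x₀, ?_⟩
    have := eq_of_hasDerivAt_of_lipschitzWith hLip (hyd l (u x₀)) hu (t₀ := x₀) (hφ0 _ _)
    rw [← hu0]
    exact congrFun this x
  choose T hT using hexT
  have hTlt : ∀ l x b, y l (x, b) < 0 ↔ b < T l x := by
    intro l x b
    have h1 := hsub l x b (T l x)
    rw [hT] at h1
    have h2 : 0 < e l x b (T l x) := Real.exp_pos _
    constructor
    · intro h
      by_contra! h3
      nlinarith
    · intro h
      nlinarith [mul_pos (sub_pos.2 h) h2]
  have hTgt : ∀ l x b, 0 < y l (x, b) ↔ T l x < b := by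
    intro l x b
    have h1 := hsub l x b (T l x)
    rw [hT] at h1
    have h2 : 0 < e l x b (T l x) := Real.exp_pos _
    constructor
    · intro h
      by_contra! h3
      nlinarith
    · intro h
      nlinarith [mul_pos (sub_pos.2 h) h2]
  -- Solutions increase strictly with their initial value, so `b < T l x` and `T l x < b` are sign
  -- conditions on `y l (x, b)`, which are open in (l, x).
  have hTc : Continuous fun z : Λ × ℝ => T z.1 z.2 := by
    refine continuous_iff_continuousAt.2 fun z₀ => tendsto_order.2 ⟨fun b hb => ?_, fun b hb => ?_⟩
    · have h1 : Continuous fun z : Λ × ℝ => y z.1 (z.2, b) :=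
        hyc.comp (f := fun z : Λ × ℝ => (z.1, (z.2, b))) (by fun_prop)
      filter_upwards [h1.continuousAt.eventually_lt continuousAt_const ((hTlt _ _ _).2 hb)]
        with z hz using (hTlt _ _ _).1 hz
    · have h1 : Continuous fun z : Λ × ℝ => y z.1 (z.2, b) :=
        hyc.comp (f := fun z : Λ × ℝ => (z.1, (z.2, b))) (by fun_prop)
      filter_upwards [continuousAt_const.eventually_lt h1.continuousAt ((hTgt _ _ _).2 hb)]
        with z hz using (hTgt _ _ _).1 hz
  have hTd : ∀ l x, HasDerivAt (T l) (-(f l (x, 0)) / yb l (x, T l x)) x := by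
    intro l x
    have h1 := hyd l (T l x) x
    rw [hT] at h1
    -- Since `y l (x', T l x') = 0`, the increment of `T` times the positive quotient `e` equals `-y
    -- l (x', T l x)`, and this last function vanishes at x' = x.
    have h2 := hasDerivAt_of_sub_eq_mul (g := T l) (b := x)
      (E := fun x' => -(dslope (fun x' => y l (x', T l x)) x x' / e l x' (T l x) (T l x'))) ?_ ?_
    · refine h2.congr_deriv ?_
      rw [dslope_same _ x, h1.deriv]
      simp [hybdef, neg_div]
    · have h3 : ContinuousAt (dslope (fun x' => y l (x', T l x)) x) x :=
        continuousAt_dslope_same.2 h1.differentiableAt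
      have h4 : Continuous fun x' => e l x' (T l x) (T l x') :=
        hec.comp (f := fun x' => (l, x', T l x, T l x')) (by
          have := hTc.comp (f := fun x' : ℝ => (l, x')) (by fun_prop)
          fun_prop)
      have h5 := h3.div h4.continuousAt (Real.exp_pos _).ne'
      exact h5.neg
    · intro x'
      have h3 := hsub l x' (T l x) (T l x')
      rw [hT] at h3
      have h4 := sub_smul_dslope (fun x' => y l (x', T l x)) x x'
      simp only [smul_eq_mul, hT, sub_zero] at h4
      have h5 : e l x' (T l x) (T l x') ≠ 0 := (Real.exp_pos _).ne'
      rw [mul_neg, ← mul_div_assoc, h4]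
      field_simp
      linarith
  have hTk : ∀ k ≤ m + 1, ContDiffFamilyOn k T univ := by
    intro k
    induction k with
    | zero => exact fun _ => (ContDiffFamilyOn.zero_iff isOpen_univ).2 hTc.continuousOn
    | succ k ih =>
      intro hk
      have hk' := ih (by omega)
      refine ContDiffFamilyOn.of_fderiv (g' := fun l x =>
        (ContinuousLinearMap.toSpanSingletonCLE (𝕜 := ℝ) (E := ℝ)).toContinuousLinearMap
          (-(f l (x, 0)) / yb l (x, T l x))) isOpen_univ hTc.continuousOn
        (fun z _ => (hTd z.1 z.2).hasFDerivAt) (ContDiffFamilyOn.clm_comp _ ?_)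
      refine ContDiffFamilyOn.div isOpen_univ ?_ ?_ fun z _ => (Real.exp_pos _).ne'
      · exact (ContDiffFamilyOn.comp_univ continuous_id (hf.of_le (by omega))
          (ContDiffFamilyOn.of_contDiff (contDiff_id.prodMk contDiff_const))).neg
      · exact ContDiffFamilyOn.comp_univ continuous_id (hybF k (by omega) (hyk k (by omega)))
          ((ContDiffFamilyOn.of_contDiff contDiff_id).prodMk hk')
  exact ⟨y, e, T, fun l => (hlip l).imp fun C hC => hC.self_of_nhds, hφ0, hyd, hyk _ le_rfl,
    hec, fun l x b b' => Real.exp_pos _, hsub, hT, hTk _ le_rfl⟩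

end GraphFlow

/-! ### Taylor coefficients and their uniqueness. -/

section Taylor

/-- The lowest nonzero term would dominate the others. A general filter is allowed because the lemma
is also applied along the image of an orbit in the x-axis. -/
theorem coeff_eq_zero_of_isLittleO {l : Filter ℝ} [l.NeBot] (hl : l ≤ 𝓝[≠] 0) {m : ℕ} {d : ℕ → ℝ}
    (h : (fun a => ∑ i ∈ Finset.range (m + 1), d i * a ^ i) =o[l] fun a => a ^ m) :
    ∀ i ≤ m, d i = 0 := by
  have hl0 : l ≤ 𝓝 0 := hl.trans nhdsWithin_le_nhds
  have hne : ∀ᶠ a in l, a ≠ 0 := hl self_mem_nhdsWithin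
  have hpow : ∀ {i j : ℕ}, i ≤ j → (fun a : ℝ => a ^ j) =O[l] fun a => a ^ i := fun hij =>
    IsBigO.of_bound 1 (by
      have h1 : ∀ᶠ a : ℝ in 𝓝 0, |a| < 1 :=
        continuous_abs.continuousAt.eventually_lt continuousAt_const (by simp)
      filter_upwards [hl0 h1] with a ha
      simpa using pow_le_pow_of_le_one (abs_nonneg a) ha.le hij)
  intro i
  induction i using Nat.strong_induction_on with
  | _ i ih =>
    intro him
    have h1 : (fun a => d i * a ^ i) =o[l] fun a : ℝ => a ^ i := by
      have h2 : (fun a => ∑ j ∈ (Finset.range (m + 1)).erase i, d j * a ^ j)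
          =o[l] fun a : ℝ => a ^ i := by
        refine IsLittleO.fun_sum fun j hj => ?_
        rw [Finset.mem_erase, Finset.mem_range] at hj
        rcases lt_or_gt_of_ne hj.1 with hji | hji
        · simp [ih j hji (by omega)]
        · exact ((isLittleO_pow_pow (𝕜 := ℝ) hji).mono hl0).const_mul_left _
      refine ((h.trans_isBigO (hpow him)).sub h2).congr_left fun a => ?_
      rw [← Finset.add_sum_erase _ _ (Finset.mem_range.2 (Nat.lt_succ_of_le him))]
      ring
    by_contra hd
    have h3 : (fun a : ℝ => a ^ i) =o[l] fun a => a ^ i := by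
      refine (h1.const_mul_left (d i)⁻¹).congr_left fun a => ?_
      field_simp
    have h4 := isLittleO_irrefl' (f' := fun a : ℝ => a ^ i) (l := l)
      (hne.mono fun a ha => by simpa using pow_ne_zero i ha).frequently
    exact h4 h3

theorem taylor_expansion_isLittleO {g : ℝ → ℝ} {n : ℕ} (hg : ContDiff ℝ n g) (a : ℝ) :
    (fun x => g (a + x) - ∑ i ∈ Finset.range (n + 1), iteratedDeriv i g a / i.factorial * x ^ i)
      =o[𝓝 0] fun x : ℝ => x ^ n := by
  have h1 := taylor_isLittleO_univ (x₀ := a) hg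
  have h2 : Tendsto (fun x : ℝ => a + x) (𝓝 0) (𝓝 a) := by
    have h3 : Continuous fun x : ℝ => a + x := by fun_prop
    simpa using h3.tendsto 0
  refine (h1.comp_tendsto h2).congr (fun x => ?_) fun x => by simp
  simp only [Function.comp, taylor_within_apply, iteratedDerivWithin_univ, add_sub_cancel_left,
    smul_eq_mul]
  congr 1
  refine Finset.sum_congr rfl fun i _ => ?_
  ring

/-- The additional derivative lets the Peano remainder be taken one order higher; the extra Taylor
term is itself of the required size. -/
theorem taylor_expansion_isBigO {g : ℝ → ℝ} {n : ℕ} (hg : ContDiff ℝ ((n + 1 : ℕ)) g) (a : ℝ) :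
    (fun x => g (a + x) - ∑ i ∈ Finset.range (n + 1), iteratedDeriv i g a / i.factorial * x ^ i)
      =O[𝓝 0] fun x : ℝ => x ^ (n + 1) := by
  have h1 := (taylor_expansion_isLittleO hg a).isBigO
  have h2 := (isBigO_refl (fun x : ℝ => x ^ (n + 1)) (𝓝 0)).const_mul_left
    (iteratedDeriv (n + 1) g a / (n + 1).factorial)
  refine (h1.add h2).congr_left fun x => ?_
  rw [Finset.sum_range_succ _ (n + 1)]
  ring

theorem iteratedDeriv_div_factorial_eq {g : ℝ → ℝ} {n : ℕ} (hg : ContDiff ℝ n g) {a : ℝ}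
    {c : ℕ → ℝ} (h : (fun x => g (a + x) - ∑ i ∈ Finset.range (n + 1), c i * x ^ i)
      =o[𝓝[≠] 0] fun x : ℝ => x ^ n) :
    ∀ i ≤ n, iteratedDeriv i g a / i.factorial = c i := by
  intro i hi
  have h1 := h.sub ((taylor_expansion_isLittleO hg a).mono nhdsWithin_le_nhds)
  have h2 := coeff_eq_zero_of_isLittleO (d := fun i => iteratedDeriv i g a / i.factorial - c i)
    le_rfl (h1.congr_left fun x => by
      simp only [sub_mul, Finset.sum_sub_distrib]
      ring) i hi
  linarith

end Taylor

/-! ### Reparametrisations of the interval. -/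

section Reparametrisation

open scoped ContDiff

/-- Translations near `0`, cut off to diffeomorphisms of `(-ε, ε)`. -/
theorem exists_cutoff_translation (r : ℕ∞) {ε : ℝ} (hε : 0 < ε) :
    ∃ (ε' : ℝ) (H : ℝ → ℝ → ℝ), 0 < ε' ∧ Continuous (fun z : ℝ × ℝ => H z.1 z.2) ∧
      (∀ a, H a 0 = a) ∧ (∀ a, ∀ᶠ x in 𝓝 0, H a x = a + x) ∧
      ∀ a, |a| < ε' → IsCrDiffeoOn r (H a) (Ioo (-ε) ε) := by
  let ψ : ContDiffBump (0 : ℝ) := ⟨ε / 3, ε / 2, by positivity, by linarith⟩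
  have hψ : ContDiff ℝ ∞ ψ := ψ.contDiff
  have hψd : ∀ x, HasDerivAt ψ (deriv ψ x) x := fun x =>
    (hψ.differentiable (by simp) x).hasDerivAt
  obtain ⟨C, hC⟩ : ∃ C, ∀ x, ‖deriv ψ x‖ ≤ C :=
    ψ.hasCompactSupport.deriv.exists_bound_of_continuous (hψ.continuous_deriv (by simp))
  have hC0 : 0 ≤ C := (norm_nonneg _).trans (hC 0)
  have hone : ∀ᶠ x in 𝓝 (0 : ℝ), ψ x = 1 := ψ.eventuallyEq_one
  have hout : ∀ x, ε ≤ |x| → ψ x = 0 := fun x hx => by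
    refine ψ.zero_of_le_dist ?_
    rw [Real.dist_eq, sub_zero]
    change ε / 2 ≤ |x|
    linarith
  -- The bound on `a` keeps |a ψ'| below 1, so that x + a ψ(x) is strictly increasing; outside (-ε,
  -- ε) it is the identity.
  refine ⟨1 / (2 * (C + 1)), fun a x => x + a * ψ x, by positivity, ?_, fun a => ?_,
    fun a => ?_, fun a ha => ?_⟩
  · have := ψ.continuous
    fun_prop
  · simp [hone.self_of_nhds]
  · filter_upwards [hone] with x hx
    rw [hx]
    ring
  have hd : ∀ x, HasDerivAt (fun x => x + a * ψ x) (1 + a * deriv ψ x) x := fun x =>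
    (hasDerivAt_id x).add ((hψd x).const_mul a)
  have hpos : ∀ x, 0 < 1 + a * deriv ψ x := by
    intro x
    have h1 : |a * deriv ψ x| ≤ 1 / (2 * (C + 1)) * C := by
      rw [abs_mul]
      exact mul_le_mul ha.le (hC x) (abs_nonneg _) (by positivity)
    have h2 : 1 / (2 * (C + 1)) * C < 1 := by
      rw [div_mul_eq_mul_div, div_lt_one (by positivity)]
      linarith
    linarith [(abs_le.1 h1).1]
  have hmono : StrictMono fun x => x + a * ψ x :=
    strictMono_of_deriv_pos fun x => by rw [(hd x).deriv]; exact hpos x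
  have hcd : ContDiff ℝ ∞ fun x => x + a * ψ x := contDiff_id.add (contDiff_const.mul hψ)
  have hfix : ∀ x, ε ≤ |x| → x + a * ψ x = x := fun x hx => by simp [hout x hx]
  have hε1 := hfix ε (le_abs_self ε)
  have hε2 := hfix (-ε) (by rw [abs_neg]; exact le_abs_self ε)
  have hmap : MapsTo (fun x => x + a * ψ x) (Ioo (-ε) ε) (Ioo (-ε) ε) := fun x hx =>
    ⟨by simpa only [hε2] using hmono hx.1, by simpa only [hε1] using hmono hx.2⟩
  have hsurj : Function.Surjective fun x => x + a * ψ x := by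
    refine hcd.continuous.surjective ?_ ?_
    · refine tendsto_id.congr' ?_
      filter_upwards [eventually_ge_atTop ε] with x hx
      exact (hfix x (hx.trans (le_abs_self x))).symm
    · refine tendsto_id.congr' ?_
      filter_upwards [eventually_le_atBot (-ε)] with x hx
      exact (hfix x ((le_neg.1 hx).trans (neg_le_abs x))).symm
  let φ : ℝ ≃ₜ ℝ := (hmono.orderIsoOfSurjective _ hsurj).toHomeomorph
  have hφ : ∀ x, φ x = x + a * ψ x := fun x => rfl
  have hsymm : ContDiff ℝ ∞ φ.symm :=
    φ.contDiff_symm_deriv (fun x => (hpos x).ne') hd hcd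
  have hr : ((r : ℕ∞) : WithTop ℕ∞) ≤ ∞ := by exact_mod_cast le_top
  refine ⟨(hcd.of_le hr).contDiffOn, hmap, φ.symm, (hsymm.of_le hr).contDiffOn, fun x hx => ?_,
    fun x _ => φ.symm_apply_apply x, fun x _ => φ.apply_symm_apply x⟩
  have h1 : φ (φ.symm x) = x := φ.apply_symm_apply x
  constructor
  · refine (hmono.lt_iff_lt (a := -ε)).1 ?_
    simp only [hε2]
    rw [← hφ, h1]
    exact hx.1
  · refine (hmono.lt_iff_lt (b := ε)).1 ?_
    simp only [hε1]
    rw [← hφ, h1]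
    exact hx.2

end Reparametrisation

/-! ### Persistence of simple zeros. -/

section ZeroOfFamily

variable {Λ : Type*} [TopologicalSpace Λ]

/-- A simple zero of a member of a family persists, depends continuously on the parameter, and is
locally unique. -/
theorem exists_continuousOn_zero {G G' : Λ → ℝ → ℝ}
    (hG : Continuous fun z : Λ × ℝ => G z.1 z.2) (hG' : Continuous fun z : Λ × ℝ => G' z.1 z.2)
    (hd : ∀ l x, HasDerivAt (G l) (G' l x) x) {l₀ : Λ} (h0 : G l₀ 0 = 0) (h1 : G' l₀ 0 ≠ 0)
    {ε : ℝ} (hε : 0 < ε) :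
    ∃ (ε' : ℝ) (V : Set Λ) (α : Λ → ℝ), 0 < ε' ∧ ε' ≤ ε ∧ IsOpen V ∧ l₀ ∈ V ∧ ContinuousOn α V ∧
      (∀ l ∈ V, α l ∈ Ioo (-ε') ε' ∧ G l (α l) = 0 ∧ 0 < G' l₀ 0 * G' l (α l)) ∧
      ∀ l ∈ V, ∀ x ∈ Ioo (-ε') ε', G l x = 0 → x = α l := by
  -- Multiplication by `s` makes the functions increasing near the zero, whichever sign the
  -- derivative has.
  set s := G' l₀ 0 with hs
  have hev : ∀ᶠ z : Λ × ℝ in 𝓝 (l₀, 0), 0 < s * G' z.1 z.2 :=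
    continuousAt_const.eventually_lt (continuous_const.mul hG').continuousAt
      (show 0 < s * G' l₀ 0 from mul_self_pos.2 h1)
  rw [nhds_prod_eq, eventually_prod_iff] at hev
  obtain ⟨pa, hpa, pb, hpb, hp⟩ := hev
  obtain ⟨ε₁, hε₁, hball⟩ := Metric.eventually_nhds_iff.1 hpb
  set ε' := min ε (ε₁ / 2) with hε'
  have hε'0 : 0 < ε' := by positivity
  have hin : ∀ x ∈ Icc (-ε') ε', pb x := fun x hx => by
    refine hball ?_
    rw [Real.dist_eq, sub_zero]
    have : |x| ≤ ε' := abs_le.2 hx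
    have : ε' ≤ ε₁ / 2 := min_le_right _ _
    linarith
  have hmono : ∀ l, pa l → StrictMonoOn (fun x => s * G l x) (Icc (-ε') ε') := by
    intro l hl
    refine strictMonoOn_of_deriv_pos (convex_Icc _ _) ?_ ?_
    · exact fun x _ => ((hd l x).const_mul s).continuousAt.continuousWithinAt
    · intro x hx
      rw [interior_Icc] at hx
      rw [((hd l x).const_mul s).deriv]
      exact hp hl (hin x (Ioo_subset_Icc_self hx))
  have hGc : ∀ x, Continuous fun l => s * G l x := fun x =>
    continuous_const.mul (hG.comp (f := fun l => (l, x)) (by fun_prop))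
  have hm0 : (-ε') ∈ Icc (-ε') ε' := ⟨le_rfl, by linarith⟩
  have hm1 : ε' ∈ Icc (-ε') ε' := ⟨by linarith, le_rfl⟩
  have hm2 : (0 : ℝ) ∈ Icc (-ε') ε' := ⟨by linarith, hε'0.le⟩
  have hpa0 := hpa.self_of_nhds
  have hneg : ∀ᶠ l in 𝓝 l₀, s * G l (-ε') < 0 :=
    (hGc _).continuousAt.eventually_lt continuousAt_const (by
      simpa [h0] using hmono l₀ hpa0 hm0 hm2 (by linarith : -ε' < 0))
  have hpos : ∀ᶠ l in 𝓝 l₀, 0 < s * G l ε' :=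
    continuousAt_const.eventually_lt (hGc _).continuousAt (by
      simpa [h0] using hmono l₀ hpa0 hm2 hm1 hε'0)
  obtain ⟨V, hV, hVo, hV0⟩ := eventually_nhds_iff.1 (hpa.and (hneg.and hpos))
  have hex : ∀ l, ∃ x, l ∈ V → x ∈ Ioo (-ε') ε' ∧ s * G l x = 0 := by
    intro l
    by_cases hl : l ∈ V
    · have hc : ContinuousOn (fun x => s * G l x) (Icc (-ε') ε') :=
        fun x _ => ((hd l x).const_mul s).continuousAt.continuousWithinAt
      obtain ⟨x, hx, hx0⟩ := intermediate_value_Ioo (by linarith : -ε' ≤ ε') hc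
        ⟨(hV l hl).2.1, (hV l hl).2.2⟩
      exact ⟨x, fun _ => ⟨hx, hx0⟩⟩
    · exact ⟨0, fun h => absurd h hl⟩
  choose α hα using hex
  refine ⟨ε', V, α, hε'0, min_le_left _ _, hVo, hV0, ?_, fun l hl => ?_, fun l hl x hx h => ?_⟩
  · intro l₁ hl₁
    -- A number `c` on one side of the zero for `l₁` gives a strict sign of `s * G l₁ c`. The sign
    -- persists for nearby `l`, and monotonicity keeps the zero on the same side of `c`.
    refine tendsto_order.2 ⟨fun c hc => ?_, fun c hc => ?_⟩
    · rcases le_or_gt c (-ε') with hc' | hc'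
      · filter_upwards [self_mem_nhdsWithin] with l hl
        exact hc'.trans_lt (hα l hl).1.1
      · have hcI : c ∈ Icc (-ε') ε' := ⟨hc'.le, (hc.trans (hα _ hl₁).1.2).le⟩
        have h2 := hmono l₁ (hV _ hl₁).1 hcI (Ioo_subset_Icc_self (hα _ hl₁).1) hc
        simp only [(hα _ hl₁).2] at h2
        filter_upwards [self_mem_nhdsWithin, nhdsWithin_le_nhds
          ((hGc c).continuousAt.eventually_lt continuousAt_const h2)] with l hl h3
        refine ((hmono l (hV _ hl).1).lt_iff_lt hcI (Ioo_subset_Icc_self (hα _ hl).1)).1 ?_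
        simpa only [(hα _ hl).2] using h3
    · rcases le_or_gt ε' c with hc' | hc'
      · filter_upwards [self_mem_nhdsWithin] with l hl
        exact (hα l hl).1.2.trans_le hc'
      · have hcI : c ∈ Icc (-ε') ε' := ⟨((hα _ hl₁).1.1.trans hc).le, hc'.le⟩
        have h2 := hmono l₁ (hV _ hl₁).1 (Ioo_subset_Icc_self (hα _ hl₁).1) hcI hc
        simp only [(hα _ hl₁).2] at h2
        filter_upwards [self_mem_nhdsWithin, nhdsWithin_le_nhds
          (continuousAt_const.eventually_lt (hGc c).continuousAt h2)] with l hl h3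
        refine ((hmono l (hV _ hl).1).lt_iff_lt (Ioo_subset_Icc_self (hα _ hl).1) hcI).1 ?_
        simpa only [(hα _ hl).2] using h3
  · exact ⟨(hα l hl).1, (mul_eq_zero.1 (hα l hl).2).resolve_left h1,
      hp (hV l hl).1 (hin _ (Ioo_subset_Icc_self (hα l hl).1))⟩
  · refine (hmono l (hV l hl).1).injOn (Ioo_subset_Icc_self hx)
      (Ioo_subset_Icc_self (hα l hl).1) ?_
    simp only [(hα l hl).2, h, mul_zero]

end ZeroOfFamily

/-! ### Smooth cutoff functions. -/

section Cutoffs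

open scoped ContDiff

/-- A smooth positive modification of the identity which is unchanged on `[c, ∞)`. -/
noncomputable def positiveCutoff (c u : ℝ) : ℝ :=
  c + Real.smoothTransition (2 * u / c - 1) * (u - c)

theorem positiveCutoff_of_le {c u : ℝ} (hc : 0 < c) (hu : c ≤ u) : positiveCutoff c u = u := by
  have : 1 ≤ 2 * u / c - 1 := by
    rw [le_sub_iff_add_le, le_div_iff₀ hc]
    linarith
  simp [positiveCutoff, Real.smoothTransition.one_of_one_le this]

theorem positiveCutoff_zero (c : ℝ) : positiveCutoff c 0 = c := by
  simp [positiveCutoff, Real.smoothTransition.zero_of_nonpos]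

theorem positiveCutoff_pos {c : ℝ} (hc : 0 < c) (u : ℝ) : 0 < positiveCutoff c u := by
  unfold positiveCutoff
  rcases le_or_gt u (c / 2) with h | h
  · have : 2 * u / c - 1 ≤ 0 := by
      rw [sub_nonpos, div_le_one hc]
      linarith
    simpa [Real.smoothTransition.zero_of_nonpos this] using hc
  · have h1 := Real.smoothTransition.nonneg (2 * u / c - 1)
    have h2 := Real.smoothTransition.le_one (2 * u / c - 1)
    nlinarith

theorem contDiff_positiveCutoff (c : ℝ) : ContDiff ℝ ∞ (positiveCutoff c) := by
  unfold positiveCutoff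
  refine contDiff_const.add ((Real.smoothTransition.contDiff.comp ?_).mul
    (contDiff_id.sub contDiff_const))
  exact ((contDiff_const.mul contDiff_id).div_const c).sub contDiff_const

theorem exists_contDiff_eq_one_of_isCompact {K U : Set (ℝ × ℝ)} (hK : IsCompact K) (hU : IsOpen U)
    (hKU : K ⊆ U) : ∃ χ : ℝ × ℝ → ℝ, ContDiff ℝ ∞ χ ∧ HasCompactSupport χ ∧ tsupport χ ⊆ U ∧
      ∀ p ∈ K, χ p = 1 := by
  obtain ⟨K', hK', hKK', hK'U⟩ := exists_compact_between hK hU hKU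
  obtain ⟨χ, h1, -, h3, h4⟩ := exists_contMDiff_support_eq_eq_one_iff (n := ⊤)
    (modelWithCornersSelf ℝ (ℝ × ℝ)) isOpen_interior hK.isClosed hKK'
  have h5 : tsupport χ ⊆ K' := by
    rw [tsupport, h3]
    exact hK'.isClosed.closure_interior_subset
  exact ⟨χ, h1.contDiff, hK'.of_isClosed_subset (isClosed_tsupport χ) h5, h5.trans hK'U,
    fun p hp => (h4 p).1 hp⟩

end Cutoffs

/-! ### The C^r topology in terms of families. -/

section VectorFieldTopology

open scoped ContDiff

variable {M : Set (ℝ × ℝ)} {r : ℕ∞} {Λ : Type*} [TopologicalSpace Λ]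

/-- Uniform convergence on a compact neighbourhood of a point, together with continuity of the
limit's derivatives, gives joint continuity in field and point. -/
theorem CrVectorField.contDiffFamilyOn (hM : IsOpen M) {k : ℕ} (hk : (k : ℕ∞) ≤ r) :
    ContDiffFamilyOn k (fun X : CrVectorField M r => X.toFun) (univ ×ˢ M) := by
  refine ⟨fun z hz => ((z.1.contDiffOn.contDiffAt (hM.mem_nhds hz.2))).of_le
    (by exact_mod_cast hk), fun j hj => ?_⟩
  rintro ⟨X₀, p₀⟩ hz
  refine ContinuousAt.continuousWithinAt ?_
  have hp₀ : p₀ ∈ M := hz.2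
  obtain ⟨K, hK, hp₀K, hKM⟩ := exists_compact_subset hM hp₀
  have hc : Continuous fun X : CrVectorField M r =>
      UniformOnFun.ofFun {K : Set (ℝ × ℝ) | IsCompact K ∧ K ⊆ M} (iteratedFDeriv ℝ j X.toFun) :=
    continuous_iInf_dom (i := ⟨j, le_trans (by exact_mod_cast hj) hk⟩) continuous_induced_dom
  have hu := UniformOnFun.tendsto_iff_tendstoUniformlyOn.1 (hc.tendsto X₀) K ⟨hK, hKM⟩
  have hc0 : ContinuousAt (iteratedFDeriv ℝ j X₀.toFun) p₀ :=
    (X₀.contDiffOn.contDiffAt (hM.mem_nhds hp₀)).continuousAt_iteratedFDeriv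
      (by exact_mod_cast le_trans (by exact_mod_cast hj) hk)
  rw [Metric.continuousAt_iff']
  intro ε hε
  have h1 := Metric.tendstoUniformlyOn_iff.1 hu (ε / 2) (half_pos hε)
  have h2 := Metric.continuousAt_iff'.1 hc0 (ε / 2) (half_pos hε)
  have h3 : ∀ᶠ p in 𝓝 p₀, p ∈ K := mem_interior_iff_mem_nhds.1 hp₀K
  rw [nhds_prod_eq]
  filter_upwards [h1.prod_mk (h2.and h3)] with z hz
  have h4 := hz.1 z.2 hz.2.2
  have h5 := hz.2.1
  calc dist (iteratedFDeriv ℝ j z.1.toFun z.2) (iteratedFDeriv ℝ j X₀.toFun p₀)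
      ≤ dist (iteratedFDeriv ℝ j z.1.toFun z.2) (iteratedFDeriv ℝ j X₀.toFun z.2) +
        dist (iteratedFDeriv ℝ j X₀.toFun z.2) (iteratedFDeriv ℝ j X₀.toFun p₀) :=
        dist_triangle _ _ _
    _ < ε / 2 + ε / 2 := by
        refine add_lt_add ?_ h5
        rw [dist_comm]
        exact h4
    _ = ε := by ring

/-- Conversely, joint continuity becomes uniform on compact sets. This is how the perturbing
families of fields are seen to be continuous. -/
theorem CrVectorField.continuous_of_contDiffFamilyOn {c : Λ → CrVectorField M r}
    (h : ∀ k : ℕ, (k : ℕ∞) ≤ r → ContDiffFamilyOn k (fun l => (c l).toFun) (univ ×ˢ M))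
    (hM : IsOpen M) : Continuous c := by
  refine continuous_iInf_rng.2 fun k => continuous_induced_rng.2 ?_
  refine continuous_iff_continuousAt.2 fun l₀ =>
    UniformOnFun.tendsto_iff_tendstoUniformlyOn.2 fun K hK => ?_
  have hc := (h k.1 k.2).2 k.1 le_rfl
  refine Metric.tendstoUniformlyOn_iff.2 fun ε hε => ?_
  refine hK.1.eventually_forall_of_forall_eventually fun p hp => ?_
  have h1 : ContinuousAt (fun z : Λ × (ℝ × ℝ) => iteratedFDeriv ℝ k.1 (c z.1).toFun z.2) (l₀, p) :=
    hc.continuousAt ((isOpen_univ.prod hM).mem_nhds ⟨mem_univ _, hK.2 hp⟩)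
  have h2 : ContinuousAt (fun z : Λ × (ℝ × ℝ) => iteratedFDeriv ℝ k.1 (c l₀).toFun z.2) (l₀, p) :=
    ContinuousAt.comp (f := fun z : Λ × (ℝ × ℝ) => (l₀, z.2))
      (g := fun z : Λ × (ℝ × ℝ) => iteratedFDeriv ℝ k.1 (c z.1).toFun z.2) h1 (by fun_prop)
  exact (h2.dist h1).eventually_lt continuousAt_const (by simpa using hε)

theorem CrVectorField.contDiffFamilyOn_smul (hM : IsOpen M) {k : ℕ} (hk : (k : ℕ∞) ≤ r)
    {χ : ℝ × ℝ → ℝ} (hχ : ContDiff ℝ ∞ χ) (hs : tsupport χ ⊆ M) :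
    ContDiffFamilyOn k (fun (X : CrVectorField M r) p => χ p • X p) univ := by
  refine ContDiffFamilyOn.of_forall_mem_nhds fun z _ => ?_
  by_cases hz : z.2 ∈ M
  · refine ⟨univ ×ˢ M, (isOpen_univ.prod hM).mem_nhds ⟨mem_univ _, hz⟩, ?_⟩
    exact ContDiffFamilyOn.bilinear (isOpen_univ.prod hM) (ContinuousLinearMap.lsmul ℝ ℝ)
      ((ContDiffFamilyOn.of_contDiff (hχ.of_le (by exact_mod_cast le_top))).mono (subset_univ _))
      (CrVectorField.contDiffFamilyOn hM hk)
  · have ho : IsOpen ((univ : Set (CrVectorField M r)) ×ˢ (tsupport χ)ᶜ) :=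
      isOpen_univ.prod (isClosed_tsupport χ).isOpen_compl
    refine ⟨_, ho.mem_nhds ⟨mem_univ _, fun h => hz (hs h)⟩, ?_⟩
    refine ((ContDiffFamilyOn.of_contDiff (contDiff_const (c := (0 : ℝ × ℝ)))).mono
      (subset_univ _)).congr ho fun w hw => ?_
    simp [image_eq_zero_of_notMem_tsupport hw.2]

end VectorFieldTopology

/-! ### Iterated Lie derivatives of the height. -/

section LieDerivatives

theorem lieIterHeight_succ (X : ℝ × ℝ → ℝ × ℝ) (i : ℕ) :
    lieIterHeight X (i + 1) = lieDerivAlong X (lieIterHeight X i) :=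
  Function.iterate_succ_apply' _ _ _

theorem lieIterHeight_congr {X Y : ℝ × ℝ → ℝ × ℝ} {p : ℝ × ℝ} (h : X =ᶠ[𝓝 p] Y) (i : ℕ) :
    lieIterHeight X i =ᶠ[𝓝 p] lieIterHeight Y i := by
  induction i with
  | zero => exact EventuallyEq.rfl
  | succ i ih =>
    rw [lieIterHeight_succ, lieIterHeight_succ]
    filter_upwards [h, ih.fderiv (𝕜 := ℝ)] with q h1 h2
    rw [lieDerivAlong, lieDerivAlong, h1, h2]

/-- The height is smooth, so the first Lie derivative costs no differentiation of the field and each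
later one costs a single order; hence m + 1 - i. -/
theorem ContDiffFamilyOn.lieIterHeight {Λ : Type*} [TopologicalSpace Λ] {V : Λ → ℝ × ℝ → ℝ × ℝ}
    {m : ℕ} (hV : ContDiffFamilyOn m V univ) (i : ℕ) (hi : i ≤ m + 1) :
    ContDiffFamilyOn (m + 1 - i) (fun l => lieIterHeight (V l) i) univ := by
  induction i with
  | zero => exact ContDiffFamilyOn.of_contDiff contDiff_snd
  | succ i ih =>
    have h1 := ih (by omega)
    rw [show m + 1 - i = (m - i) + 1 by omega] at h1
    rw [show m + 1 - (i + 1) = m - i by omega]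
    have h2 := ContDiffFamilyOn.bilinear isOpen_univ (ContinuousLinearMap.id ℝ (ℝ × ℝ →L[ℝ] ℝ))
      (h1.fderiv_family isOpen_univ) (hV.of_le (by omega))
    simp only [lieIterHeight_succ]
    exact h2

/-- The derivatives of the height along an integral curve are the iterated Lie derivatives. -/
theorem iteratedDeriv_height {V : ℝ × ℝ → ℝ × ℝ} {n : ℕ} (hV : ContDiff ℝ n V) {Γ : ℝ → ℝ × ℝ}
    (hΓ : ∀ t, HasDerivAt Γ (V (Γ t)) t) :
    ContDiff ℝ n (fun t => (Γ t).2) ∧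
      ∀ i ≤ n, iteratedDeriv i (fun t => (Γ t).2) = fun t => lieIterHeight V i (Γ t) := by
  have hd : ∀ i ≤ n, ∀ p, DifferentiableAt ℝ (lieIterHeight V i) p := by
    intro i hi p
    have h1 := (ContDiffFamilyOn.of_contDiff (Λ := Unit) hV).lieIterHeight i (by omega)
    exact (h1.contDiff ()).differentiable (by
      simp only [ne_eq, Nat.cast_eq_zero]
      omega) p
  have hd' : ∀ i ≤ n, ∀ t, HasDerivAt (fun t => lieIterHeight V i (Γ t))
      (lieIterHeight V (i + 1) (Γ t)) t := fun i hi t => by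
    rw [lieIterHeight_succ]
    exact (hd i hi _).hasFDerivAt.comp_hasDerivAt t (hΓ t)
  have h1 : ∀ i ≤ n, iteratedDeriv i (fun t => (Γ t).2) = fun t => lieIterHeight V i (Γ t) := by
    intro i
    induction i with
    | zero => intro _; rw [iteratedDeriv_zero]; rfl
    | succ i ih =>
      intro hi
      rw [iteratedDeriv_succ, ih (by omega)]
      funext t
      exact (hd' i (by omega) t).deriv
  refine ⟨?_, h1⟩
  have := contDiff_of_differentiable_iteratedDeriv (𝕜 := ℝ) (n := (n : ℕ∞))
    (f := fun t => (Γ t).2) fun i hi => by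
      have hi' : i ≤ n := by exact_mod_cast hi
      rw [h1 i hi']
      exact fun t => (hd' i hi' t).differentiableAt
  exact_mod_cast this

end LieDerivatives

/-! ### Cut off vector fields, their flows and slopes. -/

section CutoffField

open scoped ContDiff NNReal

/-- A vector field cut off by `χ`, with first component kept of sign `δ`. -/
noncomputable def cutoffField (δ c : ℝ) (χ : ℝ × ℝ → ℝ) (V : ℝ × ℝ → ℝ × ℝ) : ℝ × ℝ → ℝ × ℝ :=
  fun p => (δ * positiveCutoff c (δ * (χ p * (V p).1)), χ p * (V p).2)

/-- The slope of the cut off vector field. -/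
noncomputable def cutoffSlope (δ c : ℝ) (χ : ℝ × ℝ → ℝ) (V : ℝ × ℝ → ℝ × ℝ) : ℝ × ℝ → ℝ :=
  fun p => (cutoffField δ c χ V p).2 / (cutoffField δ c χ V p).1

/-- `χ` is a smooth function, equal to one on the compact set `K`, with compact support in `M`. -/
structure IsCutoff (M : Set (ℝ × ℝ)) (δ c : ℝ) (χ : ℝ × ℝ → ℝ) (K : Set (ℝ × ℝ)) : Prop where
  isOpen : IsOpen M
  mul_self : δ * δ = 1
  pos : 0 < c
  contDiff : ContDiff ℝ ∞ χ
  hasCompactSupport : HasCompactSupport χ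
  tsupport_subset : tsupport χ ⊆ M
  isCompact : IsCompact K
  eq_one : ∀ p ∈ K, χ p = 1

namespace IsCutoff

variable {M : Set (ℝ × ℝ)} {r : ℕ∞} {δ c : ℝ} {χ : ℝ × ℝ → ℝ} {K : Set (ℝ × ℝ)}

theorem subset (h : IsCutoff M δ c χ K) : K ⊆ M := fun p hp =>
  h.tsupport_subset (subset_tsupport χ (by simp [h.eq_one p hp]))

theorem fst_pos (h : IsCutoff M δ c χ K) (V : ℝ × ℝ → ℝ × ℝ) (p : ℝ × ℝ) :
    0 < δ * (cutoffField δ c χ V p).1 := by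
  have := positiveCutoff_pos h.pos (δ * (χ p * (V p).1))
  rw [cutoffField, ← mul_assoc, h.mul_self, one_mul]
  exact this

theorem fst_ne_zero (h : IsCutoff M δ c χ K) (V : ℝ × ℝ → ℝ × ℝ) (p : ℝ × ℝ) :
    (cutoffField δ c χ V p).1 ≠ 0 := fun h0 => by
  have := h.fst_pos V p
  simp [h0] at this

theorem eq_of_mem (h : IsCutoff M δ c χ K) {V : ℝ × ℝ → ℝ × ℝ} {p : ℝ × ℝ} (hp : p ∈ K)
    (hV : c ≤ δ * (V p).1) : cutoffField δ c χ V p = V p := by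
  rw [cutoffField, h.eq_one p hp, one_mul, one_mul, positiveCutoff_of_le h.pos hV, ← mul_assoc,
    h.mul_self, one_mul]

theorem eq_of_notMem (V : ℝ × ℝ → ℝ × ℝ) {p : ℝ × ℝ} (hp : p ∉ tsupport χ) :
    cutoffField δ c χ V p = (δ * c, 0) := by
  simp [cutoffField, image_eq_zero_of_notMem_tsupport hp, positiveCutoff_zero]

theorem slope_eq_zero_of_notMem (V : ℝ × ℝ → ℝ × ℝ) {p : ℝ × ℝ} (hp : p ∉ tsupport χ) :
    cutoffSlope δ c χ V p = 0 := by
  simp [cutoffSlope, eq_of_notMem V hp]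

theorem contDiffFamilyOn_field (h : IsCutoff M δ c χ K) {k : ℕ} (hk : (k : ℕ∞) ≤ r) :
    ContDiffFamilyOn k (fun X : CrVectorField M r => cutoffField δ c χ X) univ := by
  have h0 := CrVectorField.contDiffFamilyOn_smul h.isOpen hk h.contDiff h.tsupport_subset
  have h1 := (h0.clm_comp (ContinuousLinearMap.fst ℝ ℝ ℝ)).clm_comp
    (δ • ContinuousLinearMap.id ℝ ℝ)
  have h2 := (h1.contDiff_comp ((contDiff_positiveCutoff c).of_le (by exact_mod_cast le_top))
    isOpen_univ).clm_comp (δ • ContinuousLinearMap.id ℝ ℝ)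
  have h3 := h2.prodMk (h0.clm_comp (ContinuousLinearMap.snd ℝ ℝ ℝ))
  refine h3.congr isOpen_univ fun z _ => ?_
  simp [cutoffField]

theorem contDiffFamilyOn_slope (h : IsCutoff M δ c χ K) {k : ℕ} (hk : (k : ℕ∞) ≤ r) :
    ContDiffFamilyOn k (fun X : CrVectorField M r => cutoffSlope δ c χ X) univ := by
  have h0 := h.contDiffFamilyOn_field hk
  exact ContDiffFamilyOn.div isOpen_univ (h0.clm_comp (ContinuousLinearMap.snd ℝ ℝ ℝ))
    (h0.clm_comp (ContinuousLinearMap.fst ℝ ℝ ℝ)) fun z _ => h.fst_ne_zero _ _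

theorem contDiff_field (h : IsCutoff M δ c χ K) (X : CrVectorField M r) {k : ℕ}
    (hk : (k : ℕ∞) ≤ r) : ContDiff ℝ k (cutoffField δ c χ X) :=
  (h.contDiffFamilyOn_field hk).contDiff X

theorem exists_bound_field (h : IsCutoff M δ c χ K) (X : CrVectorField M r) :
    ∃ B, ∀ p, ‖cutoffField δ c χ X p‖ ≤ B := by
  obtain ⟨B, hB⟩ := IsCompact.exists_bound_of_continuousOn h.hasCompactSupport
    (h.contDiff_field X (k := 0) (by simp)).continuous.continuousOn
  refine ⟨max B ‖(δ * c, (0 : ℝ))‖, fun p => ?_⟩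
  by_cases hp : p ∈ tsupport χ
  · exact (hB p hp).trans (le_max_left _ _)
  · rw [eq_of_notMem _ hp]
    exact le_max_right _ _

theorem exists_eventually_lipschitzWith_field (h : IsCutoff M δ c χ K) (hr : 1 ≤ r)
    (X₀ : CrVectorField M r) :
    ∃ C : ℝ≥0, ∀ᶠ X : CrVectorField M r in 𝓝 X₀, LipschitzWith C (cutoffField δ c χ X) := by
  refine (h.contDiffFamilyOn_field (k := 1) (by exact_mod_cast hr)).exists_eventually_lipschitzWith
    h.hasCompactSupport (fun X p hp => ?_) X₀
  have : cutoffField δ c χ X =ᶠ[𝓝 p] fun _ => (δ * c, 0) := by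
    filter_upwards [(isClosed_tsupport χ).isOpen_compl.mem_nhds hp] with q hq
      using eq_of_notMem _ hq
  simpa using this.fderiv_eq

/-- The flow of the cut off vector fields. -/
theorem exists_flow (h : IsCutoff M δ c χ K) (hr : 1 ≤ r) :
    ∃ Γ : CrVectorField M r → ℝ → ℝ × ℝ → ℝ × ℝ, (∀ X p, Γ X 0 p = p) ∧
      (∀ X p t, HasDerivAt (fun t => Γ X t p) (cutoffField δ c χ X (Γ X t p)) t) ∧
      Continuous fun z : CrVectorField M r × ℝ × (ℝ × ℝ) => Γ z.1 z.2.1 z.2.2 := by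
  refine exists_continuous_flow (v := fun (X : CrVectorField M r) _ p => cutoffField δ c χ X p)
    ?_ (fun X₀ => ?_) (fun X => ?_) 0
  · exact (h.contDiffFamilyOn_field (k := 0) (by simp)).continuous.comp
      (f := fun z : CrVectorField M r × ℝ × (ℝ × ℝ) => (z.1, z.2.2)) (by fun_prop)
  · obtain ⟨C, hC⟩ := h.exists_eventually_lipschitzWith_field hr X₀
    exact ⟨C, hC.mono fun X hX _ => hX⟩
  · obtain ⟨B, hB⟩ := h.exists_bound_field X
    exact ⟨B, fun _ p => hB p⟩

theorem exists_isGraphFlow_slope (h : IsCutoff M δ c χ K) {m : ℕ} (hr : ((m + 1 : ℕ) : ℕ∞) ≤ r)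
    (x₀ : ℝ) : ∃ y e T,
      IsGraphFlow (fun X : CrVectorField M r => cutoffSlope δ c χ X) x₀ m y e T :=
  exists_isGraphFlow (h.contDiffFamilyOn_slope hr) h.hasCompactSupport
    (fun X _ hp => slope_eq_zero_of_notMem X hp) x₀

/-- Consequently an orbit of the cut off field meets each vertical line at most once. -/
theorem strictMono_fst (h : IsCutoff M δ c χ K) {V : ℝ × ℝ → ℝ × ℝ} {Γ : ℝ → ℝ × ℝ}
    (hΓ : ∀ t, HasDerivAt Γ (cutoffField δ c χ V (Γ t)) t) : StrictMono fun t => δ * (Γ t).1 :=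
  strictMono_of_deriv_pos fun t => by
    have h1 : HasDerivAt (fun t => (Γ t).1) (cutoffField δ c χ V (Γ t)).1 t := (hΓ t).fst
    rw [(h1.const_mul δ).deriv]
    exact h.fst_pos _ _

/-- Integral curves of the cut off field lie on graphs of solutions of the scalar equation. -/
theorem snd_eq (h : IsCutoff M δ c χ K) {X : CrVectorField M r} {x₀ : ℝ} {m : ℕ}
    {y : CrVectorField M r → ℝ × ℝ → ℝ} {e : CrVectorField M r → ℝ → ℝ → ℝ → ℝ}
    {T : CrVectorField M r → ℝ → ℝ}
    (hy : IsGraphFlow (fun X : CrVectorField M r => cutoffSlope δ c χ X) x₀ m y e T)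
    {Γ : ℝ → ℝ × ℝ} (hΓ : ∀ t, HasDerivAt Γ (cutoffField δ c χ X (Γ t)) t) {a : ℝ}
    (h0 : Γ 0 = (a, 0)) (t : ℝ) : (Γ t).2 = y X ((Γ t).1, T X a) := by
  obtain ⟨B, hB⟩ := h.exists_bound_field X
  obtain ⟨C, hC⟩ := hy.lipschitz X
  have hx : ∀ t, HasDerivAt (fun t => (Γ t).1) (cutoffField δ c χ X (Γ t)).1 t :=
    fun t => (hΓ t).fst
  have hz : ∀ t, HasDerivAt (fun t => (Γ t).2) (cutoffField δ c χ X (Γ t)).2 t :=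
    fun t => (hΓ t).snd
  -- With the first component along Γ taken as a known function of time, the height of Γ and the
  -- height of the graph above the same abscissa solve one Lipschitz scalar equation, and both
  -- vanish at time 0.
  have hlip : ∀ t, LipschitzWith (B.toNNReal * C) fun w : ℝ =>
      (cutoffField δ c χ X (Γ t)).1 * cutoffSlope δ c χ X ((Γ t).1, w) := by
    intro t
    refine LipschitzWith.of_dist_le_mul fun w w' => ?_
    rw [Real.dist_eq, ← mul_sub, abs_mul, NNReal.coe_mul, mul_assoc]
    have h1 : |(cutoffField δ c χ X (Γ t)).1| ≤ B.toNNReal :=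
      ((norm_fst_le _).trans (hB (Γ t))).trans (Real.le_coe_toNNReal B)
    have h2 := hC.dist_le_mul ((Γ t).1, w) ((Γ t).1, w')
    rw [Prod.dist_eq, dist_self, max_eq_right dist_nonneg] at h2
    exact mul_le_mul h1 h2 (abs_nonneg _) (by positivity)
  have := eq_of_hasDerivAt_of_lipschitzWith
    (v := fun t w => (cutoffField δ c χ X (Γ t)).1 * cutoffSlope δ c χ X ((Γ t).1, w)) hlip
    (f := fun t => (Γ t).2) (g := fun t => y X ((Γ t).1, T X a))
    (fun t => (hz t).congr_deriv ?_) (fun t => ?_) (t₀ := 0) (by simp [h0, hy.zero])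
  · exact congrFun this t
  · simp only [cutoffSlope, Prod.mk.eta]
    field_simp [h.fst_ne_zero X (Γ t)]
  · have h1 := (hy.hasDerivAt X (T X a) (Γ t).1).comp t (hx t)
    exact h1.congr_deriv (mul_comm _ _)

end IsCutoff

end CutoffField

/-! ### Uniqueness of orbit arcs. -/

section Arcs

open scoped ContDiff NNReal

variable {M : Set (ℝ × ℝ)}

/-- Two integral curves of a field of class `C^1` with the same initial point agree. -/
theorem IsOrbitArc.eqOn {V : ℝ × ℝ → ℝ × ℝ} (hM : IsOpen M) (hV : ContDiffOn ℝ 1 V M)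
    {γ γ' : ℝ → ℝ × ℝ} {p : ℝ × ℝ} {t : ℝ} (h : IsOrbitArc M V γ p t)
    (h' : IsOrbitArc M V γ' p t) : EqOn γ γ' (uIcc 0 t) := by
  -- Rescaling time to [0, 1] treats positive and negative `t` at once.
  have hm : MapsTo (fun s : ℝ => s * t) (Icc 0 1) (uIcc 0 t) := by
    intro s hs
    rw [mem_uIcc]
    rcases le_total 0 t with ht | ht
    · exact Or.inl ⟨mul_nonneg hs.1 ht, mul_le_of_le_one_left ht hs.2⟩
    · exact Or.inr ⟨by nlinarith [hs.1, hs.2], mul_nonpos_of_nonneg_of_nonpos hs.1 ht⟩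
  have key : ∀ {γ : ℝ → ℝ × ℝ}, IsOrbitArc M V γ p t →
      ∀ s ∈ Icc (0 : ℝ) 1, HasDerivWithinAt (fun s => γ (s * t)) (t • V (γ (s * t))) (Icc 0 1) s := by
    intro γ h s hs
    have h1 : HasDerivWithinAt (fun s : ℝ => s * t) t (Icc 0 1) s := by
      simpa using ((hasDerivAt_id s).mul_const t).hasDerivWithinAt
    exact (h.deriv _ (hm hs)).scomp s h1 hm
  have hcont : ∀ {γ : ℝ → ℝ × ℝ}, IsOrbitArc M V γ p t →
      ContinuousOn (fun s => γ (s * t)) (Icc 0 1) := fun h s hs => (key h s hs).continuousWithinAt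
  -- The field is only locally Lipschitz on `M`; it is Lipschitz on the compact union of the two
  -- arcs, which is all that uniqueness needs.
  set S : Set (ℝ × ℝ) := (fun s => γ (s * t)) '' Icc 0 1 ∪ (fun s => γ' (s * t)) '' Icc 0 1
  have hS : IsCompact S :=
    (isCompact_Icc.image_of_continuousOn (hcont h)).union
      (isCompact_Icc.image_of_continuousOn (hcont h'))
  have hSM : S ⊆ M := by
    rintro _ (⟨s, hs, rfl⟩ | ⟨s, hs, rfl⟩)
    · exact h.mem _ (hm hs)
    · exact h'.mem _ (hm hs)
  have hloc : LocallyLipschitzOn S V := fun q hq => by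
    obtain ⟨C, u, hu, hC⟩ := (hV.contDiffAt (hM.mem_nhds (hSM hq))).exists_lipschitzOnWith
    exact ⟨C, u, mem_nhdsWithin_of_mem_nhds hu, hC⟩
  obtain ⟨C, hC⟩ := hloc.exists_lipschitzOnWith_of_compact hS
  have hci : ∀ {γ : ℝ → ℝ × ℝ}, IsOrbitArc M V γ p t →
      ∀ s ∈ Ico (0 : ℝ) 1, HasDerivWithinAt (fun s => γ (s * t)) (t • V (γ (s * t))) (Ici s) s :=
    fun h s hs => (key h s (Ico_subset_Icc_self hs)).mono_of_mem_nhdsWithin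
      (mem_of_superset (Icc_mem_nhdsGE hs.2) (Icc_subset_Icc_left hs.1))
  have heq := ODE_solution_unique_of_mem_Icc_right (v := fun _ q => t • V q) (s := fun _ => S)
    (K := ‖t‖₊ * C) (a := 0) (b := 1) (f := fun s => γ (s * t)) (g := fun s => γ' (s * t))
    (fun s _ => (lipschitzWith_smul t).comp_lipschitzOnWith hC) (hcont h) (hci h)
    (fun s hs => Or.inl ⟨s, Ico_subset_Icc_self hs, rfl⟩) (hcont h') (hci h')
    (fun s hs => Or.inr ⟨s, Ico_subset_Icc_self hs, rfl⟩) (by simp [h.start, h'.start])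
  intro s hs
  rcases eq_or_ne t 0 with rfl | ht
  · obtain rfl : s = 0 := by simpa using hs
    rw [h.start, h'.start]
  · have hs1 : s / t ∈ Icc (0 : ℝ) 1 := by
      rcases mem_uIcc.1 hs with h1 | h1
      · have : 0 < t := lt_of_le_of_ne (h1.1.trans h1.2) ht.symm
        exact ⟨div_nonneg h1.1 this.le, (div_le_one this).2 h1.2⟩
      · have : t < 0 := lt_of_le_of_ne (h1.1.trans h1.2) ht
        exact ⟨div_nonneg_of_nonpos h1.2 this.le, (div_le_one_of_neg this).2 h1.1⟩
    have := heq hs1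
    simpa [div_mul_cancel₀ _ ht] using this

theorem IsOrbitArc.of_hasDerivAt {V W : ℝ × ℝ → ℝ × ℝ} {Γ : ℝ → ℝ × ℝ}
    (hΓ : ∀ t, HasDerivAt Γ (W (Γ t)) t) {t : ℝ} (hmem : ∀ s ∈ uIcc 0 t, Γ s ∈ M)
    (heq : ∀ s ∈ uIcc 0 t, W (Γ s) = V (Γ s)) : IsOrbitArc M V Γ (Γ 0) t :=
  ⟨rfl, hmem, fun s hs => by
    rw [← heq s hs]
    exact (hΓ s).hasDerivWithinAt⟩

end Arcs

/-! ### The full transition map of nearby fields. -/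

section Transition

open scoped ContDiff NNReal

variable {M : Set (ℝ × ℝ)} {r : ℕ∞}

/-- The first component keeps its sign along the arc by connectedness and is bounded away from zero
by compactness. Half of the minimum therefore remains a strict lower bound on a compact
neighbourhood of the arc. -/
theorem exists_isCutoff (hM : IsOpen M) (X₀ : CrVectorField M r) {t₀ : ℝ} {γ : ℝ → ℝ × ℝ}
    {p : ℝ × ℝ} (hγ : IsOrbitArc M X₀ γ p t₀) (hX₁ : ∀ t ∈ uIcc 0 t₀, (X₀ (γ t)).1 ≠ 0) :
    ∃ c χ K, IsCutoff M (Real.sign (X₀ p).1) c χ K ∧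
      (∀ q ∈ K, c < Real.sign (X₀ p).1 * (X₀ q).1) ∧ ∀ t ∈ uIcc 0 t₀, γ t ∈ interior K := by
  set δ := Real.sign (X₀ p).1 with hδ
  have hγc : ContinuousOn γ (uIcc 0 t₀) := fun s hs => (hγ.deriv s hs).continuousWithinAt
  have hX0c : ContinuousOn (fun q => (X₀ q).1) M := continuous_fst.comp_continuousOn
    X₀.contDiffOn.continuousOn
  have hc : ContinuousOn (fun t => (X₀ (γ t)).1) (uIcc 0 t₀) := hX0c.comp hγc hγ.mem
  have h0 : (X₀ p).1 ≠ 0 := by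
    have := hX₁ 0 left_mem_uIcc
    rwa [hγ.start] at this
  have hδ2 : δ * δ = 1 := by
    rcases Real.sign_apply_eq_of_ne_zero _ h0 with h | h <;> rw [hδ, h] <;> norm_num
  have hδc : ContinuousOn (fun t => δ * (X₀ (γ t)).1) (uIcc 0 t₀) := continuousOn_const.mul hc
  have hpos : ∀ t ∈ uIcc 0 t₀, 0 < δ * (X₀ (γ t)).1 := by
    intro t ht
    by_contra! hneg
    have h1 : 0 < δ * (X₀ (γ 0)).1 := by
      rw [hγ.start, hδ]
      exact Real.sign_mul_pos_of_ne_zero _ h0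
    obtain ⟨s, hs, hs0⟩ := isPreconnected_uIcc.intermediate_value ht left_mem_uIcc hδc
      ⟨hneg, h1.le⟩
    have hδ0 : δ ≠ 0 := fun h => by simp [h] at hδ2
    exact hX₁ s hs ((mul_eq_zero.1 hs0).resolve_left hδ0)
  obtain ⟨s, hs, hmin⟩ := isCompact_uIcc.exists_isMinOn nonempty_uIcc hδc
  set c := δ * (X₀ (γ s)).1 / 2 with hcdef
  have hc0 : 0 < c := half_pos (hpos s hs)
  have hW : IsOpen (M ∩ (fun q => δ * (X₀ q).1) ⁻¹' Ioi c) :=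
    (continuousOn_const.mul hX0c).isOpen_inter_preimage hM isOpen_Ioi
  have hsub : γ '' uIcc 0 t₀ ⊆ M ∩ (fun q => δ * (X₀ q).1) ⁻¹' Ioi c := by
    rintro _ ⟨t, ht, rfl⟩
    refine ⟨hγ.mem t ht, ?_⟩
    have h1 : δ * (X₀ (γ s)).1 ≤ δ * (X₀ (γ t)).1 := hmin ht
    have h2 := hpos s hs
    change c < δ * (X₀ (γ t)).1
    linarith
  obtain ⟨K, hK, hK1, hK2⟩ := exists_compact_between (isCompact_uIcc.image_of_continuousOn hγc)
    hW hsub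
  obtain ⟨χ, h1, h2, h3, h4⟩ := exists_contDiff_eq_one_of_isCompact hK hM
    (hK2.trans inter_subset_left)
  exact ⟨c, χ, K, ⟨hM, hδ2, hc0, h1, h2, h3, hK, h4⟩, fun q hq => (hK2 hq).2,
    fun t ht => hK1 ⟨t, ht, rfl⟩⟩

namespace IsCutoff

variable {δ c : ℝ} {χ : ℝ × ℝ → ℝ} {K : Set (ℝ × ℝ)}

/-- This ensures that cutting off leaves nearby fields unchanged on `K`. -/
theorem eventually_le_fst (h : IsCutoff M δ c χ K) {X₀ : CrVectorField M r}
    (hK : ∀ p ∈ K, c < δ * (X₀ p).1) :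
    ∀ᶠ X : CrVectorField M r in 𝓝 X₀, ∀ p ∈ K, c < δ * (X p).1 := by
  refine h.isCompact.eventually_forall_of_forall_eventually fun p hp => ?_
  have h1 := (CrVectorField.contDiffFamilyOn (r := r) h.isOpen (k := 0) (by simp)).continuousOn
  have h2 : ContinuousAt (fun z : CrVectorField M r × (ℝ × ℝ) => z.1.toFun z.2) (X₀, p) :=
    h1.continuousAt ((isOpen_univ.prod h.isOpen).mem_nhds ⟨mem_univ _, h.subset hp⟩)
  exact continuousAt_const.eventually_lt (continuousAt_const.mul h2.fst) (hK p hp)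

theorem eqOn_arc (h : IsCutoff M δ c χ K) (hr : 1 ≤ r) {X₀ : CrVectorField M r}
    (hK : ∀ p ∈ K, c < δ * (X₀ p).1) {t₀ : ℝ} {γ Γ : ℝ → ℝ × ℝ} {p : ℝ × ℝ}
    (hγ : IsOrbitArc M X₀ γ p t₀) (hγK : ∀ t ∈ uIcc 0 t₀, γ t ∈ interior K)
    (hΓ : ∀ t, HasDerivAt Γ (cutoffField δ c χ X₀ (Γ t)) t) (h0 : Γ 0 = p) :
    EqOn γ Γ (uIcc 0 t₀) := by
  have hV : ContDiff ℝ 1 (cutoffField δ c χ X₀) :=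
    h.contDiff_field X₀ (k := 1) (by exact_mod_cast hr)
  have h1 : IsOrbitArc univ (cutoffField δ c χ X₀) γ p t₀ :=
    ⟨hγ.start, fun _ _ => mem_univ _, fun s hs => by
      rw [h.eq_of_mem (interior_subset (hγK s hs)) (hK _ (interior_subset (hγK s hs))).le]
      exact hγ.deriv s hs⟩
  have h2 := IsOrbitArc.of_hasDerivAt (M := univ) (V := cutoffField δ c χ X₀) hΓ (t := t₀)
    (fun _ _ => mem_univ _) (fun _ _ => rfl)
  rw [h0] at h2
  exact h1.eqOn isOpen_univ hV.contDiffOn h2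

/-- For nearby fields and starting points the cut off orbit stays in `K`, where it is a true orbit,
up to the end of the time window. The intermediate value theorem gives a crossing of the vertical
line, monotonicity of the first coordinate its uniqueness, and the graph flow its height `T X a`. -/
theorem exists_isFullTransitionMap (h : IsCutoff M δ c χ K) (hr : 1 ≤ r)
    {X₀ : CrVectorField M r} (hK : ∀ p ∈ K, c < δ * (X₀ p).1) {t₀ : ℝ}
    {γ : ℝ → ℝ × ℝ} (hγ : IsOrbitArc M X₀ γ (0, 0) t₀)
    (hγK : ∀ t ∈ uIcc 0 t₀, γ t ∈ interior K) {ρ : ℝ} (hρ : 0 < ρ)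
    {m : ℕ} {y : CrVectorField M r → ℝ × ℝ → ℝ} {e : CrVectorField M r → ℝ → ℝ → ℝ → ℝ}
    {T : CrVectorField M r → ℝ → ℝ}
    (hy : IsGraphFlow (fun X : CrVectorField M r => cutoffSlope δ c χ X) (γ t₀).1 m y e T) :
    ∃ ε > 0, ∃ θ > 0, ∀ᶠ X : CrVectorField M r in 𝓝 X₀, ∀ ε' ≤ ε,
      IsFullTransitionMap M X (γ t₀) t₀ θ ρ ε' (T X) := by
  obtain ⟨Γ, hΓ0, hΓd, hΓc⟩ := h.exists_flow hr
  have hδ0 : δ ≠ 0 := fun h0 => by simpa [h0] using h.mul_self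
  have heq : EqOn γ (fun t => Γ X₀ t (0, 0)) (uIcc 0 t₀) :=
    h.eqOn_arc hr hK hγ hγK (hΓd X₀ _) (hΓ0 X₀ _)
  have hq : γ t₀ = Γ X₀ t₀ (0, 0) := heq right_mem_uIcc
  have hΓt : Continuous fun t => Γ X₀ t (0, 0) :=
    hΓc.comp (f := fun t : ℝ => (X₀, t, ((0 : ℝ), (0 : ℝ)))) (by fun_prop)
  have hΓz : Continuous fun z : (CrVectorField M r × ℝ) × ℝ => Γ z.1.1 z.2 (z.1.2, 0) :=
    hΓc.comp (f := fun z : (CrVectorField M r × ℝ) × ℝ => (z.1.1, z.2, (z.1.2, (0 : ℝ))))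
      (by fun_prop)
  have hnear : ∀ᶠ t in 𝓝 t₀, Γ X₀ t (0, 0) ∈ interior K ∧
      |(Γ X₀ t (0, 0)).2 - (γ t₀).2| < ρ := by
    refine (hΓt.continuousAt.eventually (isOpen_interior.mem_nhds ?_)).and ?_
    · change Γ X₀ t₀ (0, 0) ∈ interior K
      rw [← hq]
      exact hγK _ right_mem_uIcc
    · refine ContinuousAt.eventually_lt (by fun_prop) continuousAt_const ?_
      rw [hq]
      simpa using hρ
  obtain ⟨θ₁, hθ₁, hθ⟩ := Metric.eventually_nhds_iff.1 hnear
  set θ := θ₁ / 2 with hθdef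
  have hθ0 : 0 < θ := half_pos hθ₁
  have hθ' : ∀ t ∈ Icc (t₀ - θ) (t₀ + θ), Γ X₀ t (0, 0) ∈ interior K ∧
      |(Γ X₀ t (0, 0)).2 - (γ t₀).2| < ρ := fun t ht => hθ (by
    rw [Real.dist_eq, abs_lt]
    constructor <;> linarith [ht.1, ht.2])
  -- `J` contains the whole time interval from 0 to any time in the window, whatever the sign of
  -- `t₀`.
  set J := uIcc 0 t₀ ∪ Icc (t₀ - θ) (t₀ + θ) with hJ
  have hJsub : ∀ t ∈ Icc (t₀ - θ) (t₀ + θ), uIcc 0 t ⊆ J := fun t ht => by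
    refine uIcc_subset_uIcc_union_uIcc.trans (union_subset_union_right _ ?_)
    exact uIcc_subset_Icc ⟨by linarith, by linarith⟩ ht
  have hmono : ∀ X a, StrictMono fun t => δ * (Γ X t (a, 0)).1 := fun X a =>
    h.strictMono_fst (hΓd X _)
  have hE1 : ∀ᶠ z : CrVectorField M r × ℝ in 𝓝 (X₀, 0), ∀ t ∈ J,
      Γ z.1 t (z.2, 0) ∈ interior K := by
    refine (isCompact_uIcc.union isCompact_Icc).eventually_forall_of_forall_eventually fun t ht => ?_
    refine hΓz.continuousAt.eventually (isOpen_interior.mem_nhds ?_)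
    rcases ht with ht | ht
    · have h1 := hγK t ht
      rw [heq ht] at h1
      exact h1
    · exact (hθ' t ht).1
  have hE2 : ∀ᶠ z : CrVectorField M r × ℝ in 𝓝 (X₀, 0), ∀ t ∈ Icc (t₀ - θ) (t₀ + θ),
      |(Γ z.1 t (z.2, 0)).2 - (γ t₀).2| < ρ := by
    refine isCompact_Icc.eventually_forall_of_forall_eventually fun t ht => ?_
    have h1 : Continuous fun z : (CrVectorField M r × ℝ) × ℝ =>
        |(Γ z.1.1 z.2 (z.1.2, 0)).2 - (γ t₀).2| := (hΓz.snd.sub continuous_const).abs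
    exact h1.continuousAt.eventually_lt continuousAt_const (hθ' t ht).2
  have hE3 : ∀ t, Continuous fun z : CrVectorField M r × ℝ => δ * (Γ z.1 t (z.2, 0)).1 := fun t =>
    continuous_const.mul (hΓz.comp (f := fun z : CrVectorField M r × ℝ => (z, t)) (by fun_prop)).fst
  have hE4 : ∀ᶠ z : CrVectorField M r × ℝ in 𝓝 (X₀, 0),
      δ * (Γ z.1 (t₀ - θ) (z.2, 0)).1 < δ * (γ t₀).1 := by
    refine (hE3 _).continuousAt.eventually_lt continuousAt_const ?_
    rw [hq]
    exact hmono X₀ 0 (by linarith : t₀ - θ < t₀)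
  have hE5 : ∀ᶠ z : CrVectorField M r × ℝ in 𝓝 (X₀, 0),
      δ * (γ t₀).1 < δ * (Γ z.1 (t₀ + θ) (z.2, 0)).1 := by
    refine continuousAt_const.eventually_lt (hE3 _).continuousAt ?_
    rw [hq]
    exact hmono X₀ 0 (by linarith : t₀ < t₀ + θ)
  have hE := hE1.and (hE2.and (hE4.and hE5))
  rw [nhds_prod_eq, eventually_prod_iff] at hE
  obtain ⟨pa, hpa, pb, hpb, hp⟩ := hE
  obtain ⟨ε, hε, hball⟩ := Metric.eventually_nhds_iff.1 hpb
  refine ⟨ε, hε, θ, hθ0, ?_⟩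
  filter_upwards [hpa, h.eventually_le_fst hK] with X hX hXK ε' hε'
  have key : ∀ a, ∃ s, a ∈ Ioo (-ε') ε' → s ∈ Ioo (t₀ - θ) (t₀ + θ) ∧
      T X a ∈ Ioo ((γ t₀).2 - ρ) ((γ t₀).2 + ρ) ∧ FlowsTo M X (a, 0) s ((γ t₀).1, T X a) ∧
      ∀ t ∈ Ioo (t₀ - θ) (t₀ + θ), ∀ z ∈ Ioo ((γ t₀).2 - ρ) ((γ t₀).2 + ρ),
        FlowsTo M X (a, 0) t ((γ t₀).1, z) → t = s ∧ z = T X a := by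
    intro a
    by_cases ha : a ∈ Ioo (-ε') ε'
    swap
    · exact ⟨0, fun h => absurd h ha⟩
    obtain ⟨e1, e2, e4, e5⟩ := hp hX (hball (y := a) (by
      rw [Real.dist_eq, sub_zero]
      exact (abs_lt.2 ha).trans_le hε'))
    have hG : Continuous fun t => δ * (Γ X t (a, 0)).1 :=
      continuous_iff_continuousAt.2 fun t =>
        continuousAt_const.mul (hΓd X (a, 0) t).continuousAt.fst
    obtain ⟨s, hs, hs1⟩ := intermediate_value_Ioo (by linarith : t₀ - θ ≤ t₀ + θ) hG.continuousOn
      ⟨e4, e5⟩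
    have hs1' : (Γ X s (a, 0)).1 = (γ t₀).1 := mul_left_cancel₀ hδ0 hs1
    have hs2 : (Γ X s (a, 0)).2 = T X a := by
      rw [h.snd_eq hy (hΓd X (a, 0)) (hΓ0 X _) s, hs1', hy.init]
    have harc : ∀ t ∈ Icc (t₀ - θ) (t₀ + θ), IsOrbitArc M X (fun t => Γ X t (a, 0)) (a, 0) t := by
      intro t ht
      have hmem : ∀ s ∈ uIcc 0 t, Γ X s (a, 0) ∈ K := fun s hs =>
        interior_subset (e1 s (hJsub t ht hs))
      have h1 := IsOrbitArc.of_hasDerivAt (M := M) (V := X) (hΓd X (a, 0)) (t := t)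
        (fun s hs => h.subset (hmem s hs))
        (fun s hs => h.eq_of_mem (hmem s hs) (hXK _ (hmem s hs)).le)
      rwa [hΓ0] at h1
    have hpt : Γ X s (a, 0) = ((γ t₀).1, T X a) := Prod.ext hs1' hs2
    refine ⟨s, fun _ => ⟨hs, ?_, ⟨_, harc s (Ioo_subset_Icc_self hs), hpt⟩, ?_⟩⟩
    · have h1 := abs_lt.1 (e2 s (Ioo_subset_Icc_self hs))
      rw [hs2] at h1
      constructor <;> linarith
    -- A competing orbit in `M` might leave `K` a priori; uniqueness of arcs identifies it with the
    -- cut off orbit.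
    · rintro t ht z - ⟨γ', hγ', hz⟩
      have h1 : γ' t = Γ X t (a, 0) := hγ'.eqOn h.isOpen
        (X.contDiffOn.of_le (by exact_mod_cast hr)) (harc t (Ioo_subset_Icc_self ht)) right_mem_uIcc
      rw [hz] at h1
      have h2 : t = s := (hmono X a).injective (by
        rw [← h1, hs1'])
      subst h2
      exact ⟨rfl, by rw [← hs2, ← h1]⟩
  choose s hs using key
  exact ⟨s, hs⟩

end IsCutoff

end Transition

/-! ### Contact order and the jet of the transition map. -/

section Contact

open scoped ContDiff NNReal

variable {M : Set (ℝ × ℝ)} {r : ℕ∞} {δ c : ℝ} {χ : ℝ × ℝ → ℝ} {K : Set (ℝ × ℝ)}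

theorem IsCutoff.eventuallyEq_field (h : IsCutoff M δ c χ K) {X : CrVectorField M r}
    (hK : ∀ p ∈ K, c < δ * (X p).1) {p : ℝ × ℝ} (hp : p ∈ interior K) :
    cutoffField δ c χ X =ᶠ[𝓝 p] X := by
  filter_upwards [isOpen_interior.mem_nhds hp] with q hq
  exact h.eq_of_mem (interior_subset hq) (hK q (interior_subset hq)).le

/-- A contact of order `n` makes the transition map critical of order `n`. -/
theorem IsCutoff.iteratedDeriv_of_contact (h : IsCutoff M δ c χ K) {n : ℕ} (hn : 1 ≤ n)
    (hr : ((n + 1 : ℕ) : ℕ∞) ≤ r) {X₀ : CrVectorField M r} (hK : ∀ p ∈ K, c < δ * (X₀ p).1)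
    (h0K : ((0 : ℝ), (0 : ℝ)) ∈ interior K)
    (hcontact : ∀ i, 1 ≤ i → i < n → lieIterHeight X₀ i (0, 0) = 0)
    {x₀ : ℝ} {y : CrVectorField M r → ℝ × ℝ → ℝ} {e : CrVectorField M r → ℝ → ℝ → ℝ → ℝ}
    {T : CrVectorField M r → ℝ → ℝ}
    (hy : IsGraphFlow (fun X : CrVectorField M r => cutoffSlope δ c χ X) x₀ n y e T) :
    (∀ i, 1 ≤ i → i < n → iteratedDeriv i (T X₀) 0 = 0) ∧
      ∃ E > 0, iteratedDeriv n (T X₀) 0 =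
        -(lieIterHeight X₀ n (0, 0) / (E * (X₀ (0, 0)).1 ^ n)) := by
  have hr1 : 1 ≤ r := le_trans (by norm_cast; omega) hr
  obtain ⟨Γ', hΓ0', hΓd', -⟩ := h.exists_flow hr1
  set Γ : ℝ → ℝ × ℝ := fun t => Γ' X₀ t (0, 0)
  have hΓ0 : Γ 0 = (0, 0) := hΓ0' X₀ _
  have hΓd : ∀ t, HasDerivAt Γ (cutoffField δ c χ X₀ (Γ t)) t := hΓd' X₀ _
  have hloc := h.eventuallyEq_field hK h0K
  obtain ⟨hηc, hηi⟩ := iteratedDeriv_height (n := n)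
    (h.contDiff_field X₀ (k := n) (le_trans (by norm_cast; omega) hr)) hΓd
  set L := lieIterHeight X₀ n (0, 0) with hL
  have hηi' : ∀ i ≤ n, iteratedDeriv i (fun t => (Γ t).2) 0 = lieIterHeight X₀ i (0, 0) := by
    intro i hi
    rw [hηi i hi]
    simp only [hΓ0]
    exact (lieIterHeight_congr hloc i).eq_of_nhds
  -- By the contact condition only the term of order n survives in the Taylor polynomial of the
  -- height.
  have hη : (fun t => (Γ t).2 - L / n.factorial * t ^ n) =o[𝓝[≠] 0] fun t : ℝ => t ^ n := by
    refine ((taylor_expansion_isLittleO hηc 0).mono nhdsWithin_le_nhds).congr_left fun t => ?_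
    rw [Finset.sum_eq_single n]
    · rw [hηi' n le_rfl, zero_add]
    · intro i hi hin
      rw [Finset.mem_range] at hi
      rw [hηi' i (by omega)]
      rcases Nat.eq_zero_or_pos i with rfl | hi0
      · simp [lieIterHeight]
      · simp [hcontact i hi0 (by omega)]
    · intro hi
      simp at hi
  set v := (X₀ (0, 0)).1 with hv
  have hv0 : v ≠ 0 := fun h0 => by
    have := (h.pos.trans (hK _ (interior_subset h0K)))
    simp [← hv, h0] at this
  have hδ0 : δ ≠ 0 := fun h0 => by simpa [h0] using h.mul_self
  set x : ℝ → ℝ := fun t => (Γ t).1 with hx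
  have hx0 : x 0 = 0 := by simp [hx, hΓ0]
  have hxd : HasDerivAt x v 0 := by
    have h1 : HasDerivAt x (cutoffField δ c χ X₀ (Γ 0)).1 0 := (hΓd 0).fst
    rwa [hΓ0, hloc.eq_of_nhds] at h1
  have hxne : ∀ t, t ≠ 0 → x t ≠ 0 := fun t ht hxt => by
    refine ht ((h.strictMono_fst hΓd).injective ?_)
    change δ * x t = δ * x 0
    rw [hxt, hx0]
  have hxt : Tendsto x (𝓝[≠] 0) (𝓝[≠] 0) := by
    refine tendsto_nhdsWithin_iff.2 ⟨?_, ?_⟩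
    · have := hxd.continuousAt.tendsto.mono_left (nhdsWithin_le_nhds (s := {0}ᶜ))
      rwa [hx0] at this
    · filter_upwards [self_mem_nhdsWithin] with t ht using hxne t ht
  set b := T X₀ 0 with hb
  set E := e X₀ 0 b b with hE
  have hE0 : 0 < E := hy.quot_pos _ _ _ _
  have hTc : Continuous (T X₀) := (hy.contDiff_zero.contDiff X₀).continuous
  -- On the vertical line through Γ(t), the orbit of the origin is compared with the solution that
  -- vanishes there.
  have hquot : ∀ t, T X₀ (x t) - b = -((Γ t).2 / e X₀ (x t) b (T X₀ (x t))) := by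
    intro t
    have h1 := hy.sub_eq X₀ (x t) b (T X₀ (x t))
    rw [hy.zero, ← h.snd_eq hy hΓd hΓ0 t] at h1
    have h2 := (hy.quot_pos X₀ (x t) b (T X₀ (x t))).ne'
    field_simp
    linarith
  set κ := -(L / n.factorial / (E * v ^ n)) with hκ
  have hR : Tendsto (fun t => (T X₀ (x t) - b) / x t ^ n) (𝓝[≠] 0) (𝓝 κ) := by
    have h1 : Tendsto (fun t => (Γ t).2 / t ^ n) (𝓝[≠] 0) (𝓝 (L / n.factorial)) := by
      have h2 := hη.tendsto_div_nhds_zero.add_const (L / n.factorial)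
      rw [zero_add] at h2
      refine h2.congr' ?_
      filter_upwards [self_mem_nhdsWithin] with t ht
      have : t ^ n ≠ 0 := pow_ne_zero _ ht
      field_simp
      ring
    have h2 : Tendsto (fun t => x t / t) (𝓝[≠] 0) (𝓝 v) := by
      have := hasDerivAt_iff_tendsto_slope.1 hxd
      refine this.congr fun t => ?_
      simp [slope_def_field, hx0]
    have h3 : Tendsto (fun t => e X₀ (x t) b (T X₀ (x t))) (𝓝[≠] 0) (𝓝 E) := by
      have h4 : Continuous fun u => e X₀ u b (T X₀ u) :=
        hy.continuous_quot.comp (f := fun u => (X₀, u, b, T X₀ u)) (by fun_prop)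
      exact (h4.tendsto 0).comp (hxt.mono_right nhdsWithin_le_nhds)
    have h5 := (h1.div (h3.mul (h2.pow n)) (mul_ne_zero hE0.ne' (pow_ne_zero _ hv0))).neg
    refine h5.congr' ?_
    filter_upwards [self_mem_nhdsWithin] with t ht
    have ht' : t ≠ 0 := ht
    have h6 := (hy.quot_pos X₀ (x t) b (T X₀ (x t))).ne'
    have h7 := hxne t ht
    simp only [Pi.div_apply]
    rw [hquot, div_pow]
    field_simp
  -- The limit is known along the orbit, with u = x(t); pushing the punctured neighbourhood filter
  -- forward by `x` turns it into an expansion in u.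
  have hlit : (fun u => T X₀ u - b - κ * u ^ n) =o[map x (𝓝[≠] 0)] fun u : ℝ => u ^ n := by
    rw [isLittleO_map]
    refine (isLittleO_iff_tendsto' ?_).2 ?_
    · filter_upwards [self_mem_nhdsWithin] with t ht h8
      exact absurd h8 (pow_ne_zero _ (hxne t ht))
    · have h9 := hR.sub_const κ
      rw [sub_self] at h9
      refine h9.congr' ?_
      filter_upwards [self_mem_nhdsWithin] with t ht
      have h7 := hxne t ht
      simp only [Function.comp]
      field_simp
  have hTn : ContDiff ℝ n (T X₀) := (hy.contDiff_zero.contDiff X₀).of_le (by norm_cast; omega)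
  have hTay := (taylor_expansion_isLittleO hTn 0).mono
    (hxt.trans nhdsWithin_le_nhds : map x (𝓝[≠] 0) ≤ 𝓝 0)
  have hsum := coeff_eq_zero_of_isLittleO (l := map x (𝓝[≠] 0)) hxt (m := n)
    (d := fun i => iteratedDeriv i (T X₀) 0 / i.factorial - (if i = 0 then b else 0)
      - (if i = n then κ else 0)) ((hlit.sub hTay).congr_left fun u => by
        simp only [sub_mul, Finset.sum_sub_distrib, zero_add, ite_mul, zero_mul]
        rw [Finset.sum_ite_eq', Finset.sum_ite_eq']
        simp
        ring)
  constructor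
  · intro i hi hin
    have := hsum i hin.le
    simp only [show i ≠ 0 by omega, hin.ne, if_false, sub_zero, div_eq_zero_iff] at this
    exact this.resolve_right (by positivity)
  · refine ⟨E, hE0, ?_⟩
    have := hsum n le_rfl
    simp only [show n ≠ 0 by omega, if_true, if_false, sub_zero, hκ] at this
    have h10 : (n.factorial : ℝ) ≠ 0 := by positivity
    field_simp at this ⊢
    linarith

theorem IsCutoff.continuousAt_lieIterHeight (h : IsCutoff M δ c χ K) {n : ℕ}
    (hr : ((n + 1 : ℕ) : ℕ∞) ≤ r) {X₀ : CrVectorField M r} (hK : ∀ p ∈ K, c < δ * (X₀ p).1)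
    (h0K : ((0 : ℝ), (0 : ℝ)) ∈ interior K) :
    ContinuousAt (fun X : CrVectorField M r => lieIterHeight X n (0, 0)) X₀ := by
  have h1 := ((h.contDiffFamilyOn_field hr).lieIterHeight n (by omega)).continuous
  have h2 := h1.comp (f := fun X : CrVectorField M r => (X, ((0 : ℝ), (0 : ℝ)))) (by fun_prop)
  refine h2.continuousAt.congr ?_
  filter_upwards [h.eventually_le_fst hK] with X hX
  exact (lieIterHeight_congr (h.eventuallyEq_field hX h0K) n).eq_of_nhds

end Contact

/-! ### Perturbation by shears and prescription of jets. -/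

section Shear

open scoped ContDiff NNReal

variable {M : Set (ℝ × ℝ)} {r : ℕ∞} {δ c : ℝ} {χ : ℝ × ℝ → ℝ} {K : Set (ℝ × ℝ)}

/-- The pullbacks of a vector field under the shears `(x, y) ↦ (x, y + g l (x, y))`. -/
theorem IsCutoff.exists_pullback_shear (h : IsCutoff M δ c χ K) {X₀ : CrVectorField M r}
    (hK : ∀ p ∈ K, c < δ * (X₀ p).1) {Λ : Type*} [TopologicalSpace Λ] {g : Λ → ℝ × ℝ → ℝ}
    (hg : ∀ k : ℕ, ContDiffFamilyOn k g univ) {C : Set (ℝ × ℝ)} (hC : IsClosed C) (hCK : C ⊆ K)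
    (hgC : ∀ l, ∀ p ∉ C, g l p = 0) {x₀ : ℝ} (hx₀ : ∀ l b, g l (x₀, b) = 0) {m : ℕ}
    {y : CrVectorField M r → ℝ × ℝ → ℝ} {e : CrVectorField M r → ℝ → ℝ → ℝ → ℝ}
    {T : CrVectorField M r → ℝ → ℝ}
    (hy : IsGraphFlow (fun X : CrVectorField M r => cutoffSlope δ c χ X) x₀ m y e T) :
    ∃ Y : Λ → CrVectorField M r, Continuous Y ∧ (∀ l, g l = 0 → Y l = X₀) ∧
      ∀ l, (∀ p ∈ K, c < δ * (Y l p).1) → ∀ x b,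
        y (Y l) (x, b) + g l (x, y (Y l) (x, b)) = y X₀ (x, b) := by
  set W := cutoffField δ c χ X₀ with hW
  set u : Λ → ℝ × ℝ → ℝ := fun l p => fderiv ℝ (g l) p (0, 1) with hu
  set v : Λ → ℝ × ℝ → ℝ := fun l p => fderiv ℝ (g l) p (1, 0) with hv
  set Φ : Λ → ℝ × ℝ → ℝ × ℝ := fun l p => (p.1, p.2 + g l p) with hΦ
  -- This is the pullback of `W` under the shear multiplied by 1 + u. The factor removes the
  -- denominator and does not change the slope where it is nonzero.
  set P : Λ → ℝ × ℝ → ℝ × ℝ := fun l p =>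
    ((1 + u l p) * (W (Φ l p)).1, (W (Φ l p)).2 - v l p * (W (Φ l p)).1) with hP
  have hd : ∀ l p, fderiv ℝ (g l) p = 0 ∨ p ∈ C := by
    intro l p
    by_cases hp : p ∈ C
    · exact Or.inr hp
    · have : g l =ᶠ[𝓝 p] fun _ => 0 := by
        filter_upwards [hC.isOpen_compl.mem_nhds hp] with q hq using hgC l q hq
      left
      simpa using this.fderiv_eq
  have hPW : ∀ l, ∀ p ∉ C, P l p = W p := by
    intro l p hp
    have h1 := (hd l p).resolve_right hp
    simp [hP, hu, hv, hΦ, h1, hgC l p hp]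
  have hPW' : ∀ l, g l = 0 → P l = W := by
    intro l hl
    funext p
    simp [hP, hu, hv, hΦ, hl]
  have hPk : ∀ k : ℕ, (k : ℕ∞) ≤ r → ContDiffFamilyOn k (fun l p => P l p - W p) univ := by
    intro k hk
    have h1 := (hg (k + 1)).fderiv_family isOpen_univ
    have hu1 : ContDiffFamilyOn k u univ :=
      h1.clm_comp (ContinuousLinearMap.apply ℝ ℝ ((0 : ℝ), (1 : ℝ)))
    have hv1 : ContDiffFamilyOn k v univ :=
      h1.clm_comp (ContinuousLinearMap.apply ℝ ℝ ((1 : ℝ), (0 : ℝ)))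
    have hΦ1 : ContDiffFamilyOn k Φ univ :=
      (ContDiffFamilyOn.of_contDiff contDiff_fst).prodMk
        ((ContDiffFamilyOn.of_contDiff contDiff_snd).add (hg k))
    have hW1 : ContDiff ℝ k W := h.contDiff_field X₀ hk
    have hWΦ := hΦ1.contDiff_comp hW1 isOpen_univ
    have h2 := hWΦ.clm_comp (ContinuousLinearMap.fst ℝ ℝ ℝ)
    have h3 := hWΦ.clm_comp (ContinuousLinearMap.snd ℝ ℝ ℝ)
    exact ((((ContDiffFamilyOn.of_contDiff (contDiff_const (c := (1 : ℝ)))).add hu1).mul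
      isOpen_univ h2).prodMk (h3.sub (hv1.mul isOpen_univ h2))).sub
        (ContDiffFamilyOn.of_contDiff hW1)
  have hfam : ∀ k : ℕ, (k : ℕ∞) ≤ r →
      ContDiffFamilyOn k (fun l p => X₀ p + (P l p - W p)) (univ ×ˢ M) := fun k hk =>
    (ContDiffFamilyOn.of_contDiffOn h.isOpen
      (X₀.contDiffOn.of_le (by exact_mod_cast hk))).add ((hPk k hk).mono (subset_univ _))
  -- Off `C` the correction vanishes. On `C ⊆ K` the cutoff `W` equals X₀, so there `Y l` is `P l`.
  let Y : Λ → CrVectorField M r := fun l =>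
    { toFun := fun p => X₀ p + (P l p - W p)
      contDiffOn := by
        refine contDiffOn_iff_forall_nat_le.2 fun k hk p hp => ?_
        exact ((hfam k (by exact_mod_cast hk)).1 (l, p) ⟨mem_univ _, hp⟩).contDiffWithinAt
      eq_zero_of_notMem := fun p hp => by
        rw [X₀.eq_zero_of_notMem p hp, hPW l p fun h' => hp (h.subset (hCK h'))]
        simp }
  have hY : ∀ l p, Y l p = X₀ p + (P l p - W p) := fun _ _ => rfl
  refine ⟨Y, CrVectorField.continuous_of_contDiffFamilyOn hfam h.isOpen, fun l hl => ?_,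
    fun l hl x b => ?_⟩
  · have h1 : (Y l).toFun = X₀.toFun := by
      funext p
      rw [hY, hPW' l hl]
      simp
    cases hX : X₀
    rw [hX] at h1
    simpa [Y] using h1
  have hYP : cutoffField δ c χ (Y l) = P l := by
    funext p
    by_cases hp : p ∈ C
    · rw [h.eq_of_mem (hCK hp) (hl p (hCK hp)).le, hY, hW, h.eq_of_mem (hCK hp) (hK p (hCK hp)).le]
      simp
    · have h1 : Y l p = X₀ p := by simp [hY, hPW l p hp]
      rw [hPW l p hp, hW, cutoffField, cutoffField, h1]
  -- The shear carries solutions for `Y l` to solutions for X₀. Their initial values agree since the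
  -- shear fixes the line at `x₀`.
  have hz : ∀ x, HasDerivAt (fun x => y (Y l) (x, b) + g l (x, y (Y l) (x, b)))
      (cutoffSlope δ c χ X₀ (x, y (Y l) (x, b) + g l (x, y (Y l) (x, b)))) x := by
    intro x
    set w := y (Y l) (x, b) with hw
    have h1 := hy.hasDerivAt (Y l) b x
    have h2 : HasFDerivAt (g l) (fderiv ℝ (g l) (x, w)) (x, w) :=
      (((hg 1).contDiff l).differentiable (by simp) (x, w)).hasFDerivAt
    have h3 := h1.add (h2.comp_hasDerivAt x ((hasDerivAt_id x).prodMk h1))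
    refine h3.congr_deriv ?_
    set s := cutoffSlope δ c χ (Y l) (x, w) with hs
    have h4 : fderiv ℝ (g l) (x, w) (1, s) = v l (x, w) + s * u l (x, w) := by
      have : ((1 : ℝ), s) = (1, 0) + s • ((0 : ℝ), (1 : ℝ)) := by simp
      rw [this, map_add, map_smul]
      rfl
    change s + fderiv ℝ (g l) (x, w) (1, s) = _
    have h5 : (P l (x, w)).1 ≠ 0 := by
      rw [← hYP]
      exact h.fst_ne_zero _ _
    have h6 : s = (P l (x, w)).2 / (P l (x, w)).1 := by rw [hs, cutoffSlope, hYP]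
    rw [h4, h6]
    simp only [hP] at h5 ⊢
    obtain ⟨h7, h8⟩ := mul_ne_zero_iff.1 h5
    change _ = (W (Φ l (x, w))).2 / (W (Φ l (x, w))).1
    field_simp
    ring
  have := hy.eq_of_hasDerivAt X₀ hz x
  simpa only [hy.init, hx₀, add_zero] using this

theorem ContDiffFamilyOn.sum_range_mul_pow {Λ : Type*} [TopologicalSpace Λ] {k n : ℕ}
    (d : ℕ → Λ → ℝ) (hd : ∀ i < n, Continuous (d i)) :
    ContDiffFamilyOn k (fun l a => ∑ i ∈ Finset.range n, d i l * a ^ i) univ := by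
  induction n with
  | zero => simpa using ContDiffFamilyOn.of_contDiff (contDiff_const (c := (0 : ℝ)))
  | succ n ih =>
    simp only [Finset.sum_range_succ]
    exact (ih fun i hi => hd i (by omega)).add
      ((ContDiffFamilyOn.of_continuous_param (hd n (by omega))).mul isOpen_univ
        (ContDiffFamilyOn.of_contDiff (contDiff_id.pow n)))

/-- The jets of order `n - 1` at the origin of the transition maps of the fields close to `X₀` can
be prescribed. -/
theorem IsCutoff.exists_jet_family (h : IsCutoff M δ c χ K) {n : ℕ} (hn : 1 ≤ n)
    {X₀ : CrVectorField M r} (hK : ∀ p ∈ K, c < δ * (X₀ p).1)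
    (h0K : ((0 : ℝ), (0 : ℝ)) ∈ interior K) {x₀ : ℝ} (hx₀ : x₀ ≠ 0)
    {y : CrVectorField M r → ℝ × ℝ → ℝ} {e : CrVectorField M r → ℝ → ℝ → ℝ → ℝ}
    {T : CrVectorField M r → ℝ → ℝ}
    (hy : IsGraphFlow (fun X : CrVectorField M r => cutoffSlope δ c χ X) x₀ n y e T) :
    ∃ Y : (ℕ → ℝ) → CrVectorField M r, Continuous Y ∧ Y 0 = X₀ ∧
      ∀ ν, (∀ p ∈ K, c < δ * (Y ν p).1) → ∀ i < n,
        iteratedDeriv i (T (Y ν)) 0 / i.factorial =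
          iteratedDeriv i (T X₀) 0 / i.factorial + ν i := by
  -- The support of the shear is kept away from the vertical line at `x₀`, possible because `x₀ ≠
  -- 0`.
  have hU : IsOpen (interior K ∩ {p : ℝ × ℝ | |p.1| < |x₀|}) :=
    isOpen_interior.inter (isOpen_lt (by fun_prop) continuous_const)
  obtain ⟨ρ, hρ, hball⟩ := Metric.nhds_basis_closedBall.mem_iff.1
    (hU.mem_nhds (x := (0, 0)) ⟨h0K, by simpa using hx₀⟩)
  obtain ⟨ψ, hψ, -, hψU, hψ1⟩ := exists_contDiff_eq_one_of_isCompact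
    (isCompact_closedBall ((0 : ℝ), (0 : ℝ)) ρ) hU hball
  -- `p ν` is the desired transition map up to order n - 1. It would be attained exactly if the
  -- shear displaced (a, 0) by `q' ν a`.
  set p : (ℕ → ℝ) → ℝ → ℝ := fun ν a => T X₀ a + ∑ i ∈ Finset.range n, ν i * a ^ i with hp
  set q' : (ℕ → ℝ) → ℝ → ℝ := fun ν a => y X₀ (a, p ν a) with hq'
  have hq'k : ContDiffFamilyOn n q' univ := by
    have h1 : ContDiffFamilyOn n p univ :=
      (ContDiffFamilyOn.of_contDiff ((hy.contDiff_zero.contDiff X₀).of_le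
        (by norm_cast; omega))).add (ContDiffFamilyOn.sum_range_mul_pow (fun i (ν : ℕ → ℝ) => ν i)
          fun i _ => continuous_apply i)
    exact ((ContDiffFamilyOn.of_contDiff contDiff_id).prodMk h1).contDiff_comp
      ((hy.contDiff.contDiff X₀).of_le (by norm_cast; omega)) isOpen_univ
  -- The pullback differentiates the shear, so `q'` of limited smoothness is replaced by its Taylor
  -- polynomial of degree n - 1, which changes the transition map only by o(a^(n-1)).
  set q : (ℕ → ℝ) → ℝ → ℝ := fun ν a =>
    ∑ i ∈ Finset.range n, iteratedDeriv i (q' ν) 0 / i.factorial * a ^ i with hq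
  have hqk : ∀ k : ℕ, ContDiffFamilyOn k q univ := fun k =>
    ContDiffFamilyOn.sum_range_mul_pow
      (fun i (ν : ℕ → ℝ) => iteratedDeriv i (q' ν) 0 / i.factorial) fun i hi =>
      ((hq'k.continuous_iteratedDeriv hi.le).comp
        (f := fun ν : ℕ → ℝ => (ν, (0 : ℝ))) (by fun_prop)).div_const _
  obtain ⟨Y, hYc, hY0, hY⟩ := h.exists_pullback_shear hK (g := fun ν w => ψ w * q ν w.1)
    (fun k => (ContDiffFamilyOn.of_contDiff (hψ.of_le (by exact_mod_cast le_top))).mul isOpen_univ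
      ((hqk k).comp_univ continuous_id (ContDiffFamilyOn.of_contDiff contDiff_fst)))
    (isClosed_tsupport ψ) (fun w hw => interior_subset (hψU hw).1)
    (fun ν w hw => by simp [image_eq_zero_of_notMem_tsupport hw])
    (fun ν b => by
      have : (x₀, b) ∉ tsupport ψ := fun hw => lt_irrefl |x₀| (hψU hw).2
      simp [image_eq_zero_of_notMem_tsupport this]) hy
  refine ⟨Y, hYc, hY0 0 ?_, fun ν hν => ?_⟩
  · have h1 : q' 0 = fun _ => 0 := by
      funext a
      simp [hq', hp, hy.zero]
    funext w
    simp [hq, h1]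
  have hloc : ∀ᶠ a in 𝓝 (0 : ℝ),
      T (Y ν) a - p ν a = (q ν a - q' ν a) / e X₀ a (p ν a) (T (Y ν) a) := by
    filter_upwards [Metric.closedBall_mem_nhds (0 : ℝ) hρ] with a ha
    have h1 := hY ν hν a (T (Y ν) a)
    have h2 : ψ (a, 0) = 1 := hψ1 _ (by
      rw [mem_closedBall_zero_iff] at ha
      simpa [Prod.norm_def, hρ.le] using ha)
    rw [hy.zero, zero_add, h2, one_mul] at h1
    have h3 := hy.sub_eq X₀ a (p ν a) (T (Y ν) a)
    rw [eq_div_iff (hy.quot_pos _ _ _ _).ne', ← h3, h1]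
  obtain ⟨m, rfl⟩ : ∃ m, n = m + 1 := ⟨n - 1, by omega⟩
  have hT : ∀ X, ContDiff ℝ m (T X) := fun X =>
    (hy.contDiff_zero.contDiff X).of_le (by norm_cast; omega)
  have hq0 : (fun a => q ν a - q' ν a) =o[𝓝 0] fun a : ℝ => a ^ m := by
    refine (taylor_expansion_isLittleO (n := m)
      ((hq'k.contDiff ν).of_le (by norm_cast; omega)) 0).neg_left.congr_left fun a => ?_
    simp [hq]
  have hTc : ∀ X, Continuous (T X) := fun X => (hT X).continuous
  have hpc : Continuous (p ν) := (hTc X₀).add (by fun_prop)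
  have hec : Continuous fun a => e X₀ a (p ν a) (T (Y ν) a) :=
    hy.continuous_quot.comp (f := fun a => (X₀, a, p ν a, T (Y ν) a)) (by fun_prop)
  have hdiff : (fun a => T (Y ν) a - p ν a) =o[𝓝 0] fun a : ℝ => a ^ m := by
    have h1 : (fun a => (e X₀ a (p ν a) (T (Y ν) a))⁻¹) =O[𝓝 0] fun _ => (1 : ℝ) :=
      (hec.tendsto 0).inv₀ (hy.quot_pos _ _ _ _).ne' |>.isBigO_one ℝ
    refine (hq0.mul_isBigO h1).congr' ?_ (by simp)
    filter_upwards [hloc] with a ha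
    rw [ha, div_eq_mul_inv]
  have hjet := (hdiff.add (taylor_expansion_isLittleO (hT X₀) 0)).mono
    (nhdsWithin_le_nhds (s := {0}ᶜ))
  intro i hi
  refine iteratedDeriv_div_factorial_eq (n := m) (hT (Y ν)) (a := 0)
    (c := fun i => iteratedDeriv i (T X₀) 0 / i.factorial + ν i)
    (hjet.congr_left fun a => ?_) i (by omega)
  simp only [hp, add_mul, Finset.sum_add_distrib, zero_add]
  ring

end Shear

/-! ### Signs of the leading coefficient. -/

section Sign

theorem sign_eq_of_mul_pos {a b : ℝ} (h : 0 < a * b) : Real.sign a = Real.sign b := by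
  rcases mul_pos_iff.1 h with ⟨ha, hb⟩ | ⟨ha, hb⟩
  · rw [Real.sign_of_pos ha, Real.sign_of_pos hb]
  · rw [Real.sign_of_neg ha, Real.sign_of_neg hb]

theorem sign_pow_mul_pow_pos {v : ℝ} (hv : v ≠ 0) (n : ℕ) : 0 < Real.sign v ^ n * v ^ n := by
  rw [← mul_pow]
  exact pow_pos (Real.sign_mul_pos_of_ne_zero v hv) n

theorem sign_eq_neg_sign_pow_mul_sign {v L L' k E : ℝ} {n : ℕ} (hv : v ≠ 0) (hE : 0 < E)
    (h1 : 0 < -(L / (E * v ^ n)) * k) (h2 : 0 < L * L') :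
    Real.sign k = -(Real.sign v) ^ n * Real.sign L' := by
  have h3 := sign_pow_mul_pow_pos hv n
  have hvn : v ^ n ≠ 0 := pow_ne_zero n hv
  have h4 : Real.sign v ^ n = 1 ∨ Real.sign v ^ n = -1 := by
    rcases Real.sign_apply_eq_of_ne_zero v hv with h | h <;> rw [h]
    · exact neg_one_pow_eq_or ℝ n
    · exact Or.inl (one_pow n)
  rw [← sign_eq_of_mul_pos h2]
  have h5 : 0 < -(L * v ^ n) * k := by
    have : -(L * v ^ n) * k = -(L / (E * v ^ n)) * k * (E * (v ^ n) ^ 2) := by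
      field_simp
    rw [this]
    positivity
  rcases h4 with h | h <;> rw [h] at h3 ⊢
  · rw [neg_one_mul, ← Real.sign_neg]
    exact (sign_eq_of_mul_pos (by nlinarith)).symm
  · rw [neg_neg, one_mul]
    exact (sign_eq_of_mul_pos (by nlinarith)).symm

end Sign

/-! ### The abscissa of the end point of the arc. -/

section ArcEnd

variable {M : Set (ℝ × ℝ)} {r : ℕ∞} {δ c : ℝ} {χ : ℝ × ℝ → ℝ} {K : Set (ℝ × ℝ)}

theorem IsCutoff.fst_ne_zero_of_arc (h : IsCutoff M δ c χ K) (hr : 1 ≤ r) {X₀ : CrVectorField M r}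
    (hK : ∀ p ∈ K, c < δ * (X₀ p).1) {t₀ : ℝ} {γ : ℝ → ℝ × ℝ} (hγ : IsOrbitArc M X₀ γ (0, 0) t₀)
    (hγK : ∀ t ∈ uIcc 0 t₀, γ t ∈ interior K) (ht₀ : t₀ ≠ 0) : (γ t₀).1 ≠ 0 := by
  obtain ⟨Γ, hΓ0, hΓd, -⟩ := h.exists_flow hr
  rw [h.eqOn_arc hr hK hγ hγK (hΓd X₀ (0, 0)) (hΓ0 X₀ _) right_mem_uIcc]
  intro h0
  refine ht₀ ((h.strictMono_fst (hΓd X₀ (0, 0))).injective ?_)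
  simp only [h0, hΓ0]

end ArcEnd

/-! ### The normal form. -/

theorem mainTheorem5
    (M : Set (ℝ × ℝ)) (hM : IsOpen M) (r : ℕ∞) (n : ℕ) (hn : 2 ≤ n)
    (hr : ((n + 1 : ℕ) : ℕ∞) ≤ r)
    (X₀ : CrVectorField M r)
    (hcontact : HasContactOfOrder X₀ n (0, 0))
    -- condition (A): the orbit arc between the origin and `q₀ = γ t₀` lies in `M⁺` or in `M⁻`
    (t₀ : ℝ) (ht₀ : t₀ ≠ 0) (γ : ℝ → ℝ × ℝ) (hγ : IsOrbitArc M X₀ γ (0, 0) t₀)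
    (hA : (∀ t ∈ uIcc 0 t₀, t ≠ 0 → 0 < (γ t).2) ∨ (∀ t ∈ uIcc 0 t₀, t ≠ 0 → (γ t).2 < 0))
    -- the arc lies in the region where the first component of `X₀` does not vanish
    (hX₁ : ∀ t ∈ uIcc 0 t₀, (X₀ (γ t)).1 ≠ 0)
    -- the vertical section `τ` through `q₀`, transversal to `X₀` and on the same side of `Σ` as `q₀`
    (ρ : ℝ) (hρ : 0 < ρ)
    (hτ : ∀ y ∈ Ioo ((γ t₀).2 - ρ) ((γ t₀).2 + ρ),
      ((γ t₀).1, y) ∈ M ∧ 0 < y * (γ t₀).2 ∧ (X₀ ((γ t₀).1, y)).1 ≠ 0) :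
    ∃ (U₀ : Set (CrVectorField M r)) (ε θ η : ℝ)
      (T : CrVectorField M r → ℝ → ℝ) (h : CrVectorField M r → ℝ → ℝ)
      (lam₀ κ : CrVectorField M r → ℝ) (lam : ℕ → CrVectorField M r → ℝ),
      IsOpen U₀ ∧ X₀ ∈ U₀ ∧ 0 < ε ∧ 0 < θ ∧ 0 < η ∧
      -- `T X` is the full transition map of `X`
      (∀ X ∈ U₀, IsFullTransitionMap M X (γ t₀) t₀ θ ρ ε (T X)) ∧
      -- the reparametrisations of `Σ`
      (∀ X ∈ U₀, IsCrDiffeoOn r (h X) (Ioo (-ε) ε)) ∧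
      ContinuousOn (fun z : CrVectorField M r × ℝ => h z.1 z.2) (U₀ ×ˢ Ioo (-ε) ε) ∧
      h X₀ 0 = 0 ∧
      -- the parameters
      (∀ X ∈ U₀, lam₀ X = T X (h X 0)) ∧
      ContinuousOn lam₀ U₀ ∧
      (∀ i ∈ Finset.Icc 1 (n - 2), ContinuousOn (lam i) U₀ ∧ MapsTo (lam i) U₀ (Ioo (-η) η)) ∧
      (∀ μ : ℕ → ℝ, (∀ i ∈ Finset.Icc 1 (n - 2), μ i ∈ Ioo (-η) η) →
        ∃ X ∈ U₀, ∀ i ∈ Finset.Icc 1 (n - 2), lam i X = μ i) ∧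
      (∀ X ∈ U₀, Real.sign (κ X) =
        -(Real.sign (X₀ (0, 0)).1) ^ n * Real.sign (lieIterHeight X n (0, 0))) ∧
      -- the normal form
      (∀ X ∈ U₀,
        (fun x : ℝ => T X (h X x) -
          (lam₀ X + κ X * x ^ n + ∑ i ∈ Finset.Icc 1 (n - 2), lam i X * x ^ i))
          =O[𝓝 0] fun x : ℝ => x ^ (n + 1)) := by
  have hr1 : 1 ≤ r := le_trans (by norm_cast; omega) hr
  obtain ⟨-, hcont, hcontn⟩ := hcontact
  obtain ⟨c, χ, K, h, hK, hγK⟩ := exists_isCutoff hM X₀ hγ hX₁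
  set δ := Real.sign (X₀ (0, 0)).1 with hδ
  have h0K : ((0 : ℝ), (0 : ℝ)) ∈ interior K := by
    rw [← hγ.start]
    exact hγK 0 left_mem_uIcc
  have hx₀ : (γ t₀).1 ≠ 0 := h.fst_ne_zero_of_arc hr1 hK hγ hγK ht₀
  obtain ⟨y, e, T, hy⟩ := h.exists_isGraphFlow_slope hr (γ t₀).1
  obtain ⟨ε, hε, θ, hθ, htrans⟩ := h.exists_isFullTransitionMap hr1 hK hγ hγK hρ hy
  obtain ⟨ε₁, H, hε₁, hHc, hH0, hHloc, hHdiff⟩ := exists_cutoff_translation r hε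
  obtain ⟨hT0, E, hE, hTn⟩ := h.iteratedDeriv_of_contact (by omega) hr hK h0K hcont hy
  obtain ⟨Y, hYc, hY0, hY⟩ := h.exists_jet_family (by omega) hK h0K hx₀ hy
  have hTd : ∀ X, ContDiff ℝ ((n + 1 : ℕ)) (T X) := fun X => hy.contDiff_zero.contDiff X
  have hTc : ∀ i ≤ n + 1, Continuous fun z : CrVectorField M r × ℝ =>
      iteratedDeriv i (T z.1) z.2 := fun i hi => hy.contDiff_zero.continuous_iteratedDeriv hi
  set v := (X₀ (0, 0)).1 with hv
  have hv0 : v ≠ 0 := fun h0 => by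
    have := h.pos.trans (hK _ (interior_subset h0K))
    simp [← hv, h0] at this
  have hTn0 : iteratedDeriv n (T X₀) 0 ≠ 0 := by
    rw [hTn]
    exact neg_ne_zero.2 (div_ne_zero hcontn (mul_ne_zero hE.ne' (pow_ne_zero _ hv0)))
  -- `α X` is the base point at which the Taylor coefficient of order n - 1 vanishes; its uniqueness
  -- later identifies it as 0 for the constructed fields.
  obtain ⟨ε', V, α, hε', hε'₁, hV, hXV, hαc, hα, hαu⟩ := exists_continuousOn_zero
    (G := fun X a => iteratedDeriv (n - 1) (T X) a) (G' := fun X a => iteratedDeriv n (T X) a)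
    (hTc (n - 1) (by omega)) (hTc n (by omega)) (fun X a => by
      have h1 := ((hTd X).differentiable_iteratedDeriv (n - 1) (by norm_cast; omega) a).hasDerivAt
      rwa [← iteratedDeriv_succ, Nat.sub_add_cancel (by omega)] at h1)
    (hT0 (n - 1) (by omega) (by omega)) hTn0 hε₁
  have h0ε : (0 : ℝ) ∈ Ioo (-ε') ε' := ⟨by linarith, hε'⟩
  have hαX₀ : α X₀ = 0 := (hαu X₀ hXV 0 h0ε (hT0 (n - 1) (by omega) (by omega))).symm
  have hsign : ∀ᶠ X : CrVectorField M r in 𝓝 X₀,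
      0 < lieIterHeight X₀ n (0, 0) * lieIterHeight X n (0, 0) :=
    continuousAt_const.eventually_lt
      (continuousAt_const.mul (h.continuousAt_lieIterHeight hr hK h0K))
      (mul_self_pos.2 hcontn)
  obtain ⟨N, hN, hNo, hXN⟩ := eventually_nhds_iff.1
    (htrans.and (hsign.and (h.eventually_le_fst hK)))
  set lam : ℕ → CrVectorField M r → ℝ := fun i X =>
    iteratedDeriv i (T X) (α X) / i.factorial with hlam
  have hWo : IsOpen (V ∩ N) := hV.inter hNo
  have hαc' : ContinuousOn α (V ∩ N) := hαc.mono inter_subset_left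
  have hlamc : ∀ i ≤ n + 1, ContinuousOn (lam i) (V ∩ N) := fun i hi =>
    ((hTc i hi).comp_continuousOn (continuousOn_id.prodMk hαc')).div_const _
  have hlam0 : ∀ i, 1 ≤ i → i < n → lam i X₀ = 0 := fun i hi hin => by
    simp only [hlam]
    rw [hαX₀, hT0 i hi hin, zero_div]
  -- fields with prescribed parameters
  obtain ⟨η, hη, hsurj⟩ : ∃ η > 0, ∀ μ : ℕ → ℝ, (∀ i < n, μ i ∈ Ioo (-η) η) →
      μ (n - 1) = 0 → ∃ X ∈ V ∩ N, ∀ i, 1 ≤ i → i < n → lam i X = μ i := by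
    -- With finitely many coordinates, extended by zero, a neighbourhood of 0 contains a cube; its
    -- half side is η.
    let ι : (Fin n → ℝ) → ℕ → ℝ := fun w i => if hi : i < n then w ⟨i, hi⟩ else 0
    have hι : Continuous ι := continuous_pi fun i => by
      by_cases hi : i < n
      · simpa [ι, hi] using continuous_apply (⟨i, hi⟩ : Fin n)
      · simpa [ι, hi] using continuous_const
    have hι0 : ι 0 = 0 := by
      funext i
      simp [ι]
    have h1 : Y (ι 0) ∈ V ∩ N := by
      rw [hι0, hY0]
      exact ⟨hXV, hXN⟩
    obtain ⟨η, hη, hball⟩ := Metric.mem_nhds_iff.1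
      ((hYc.comp hι).continuousAt.preimage_mem_nhds (hWo.mem_nhds h1))
    refine ⟨η, hη, fun μ hμ hμ0 => ?_⟩
    set w : Fin n → ℝ := fun i => μ i
    have hw : Y (ι w) ∈ V ∩ N := hball (by
      rw [mem_ball_zero_iff, pi_norm_lt_iff hη]
      exact fun i => abs_lt.2 (hμ i i.2))
    have hjet : ∀ i, 1 ≤ i → i < n → iteratedDeriv i (T (Y (ι w))) 0 / i.factorial = μ i := by
      intro i hi hin
      rw [hY _ (hN _ hw.2).2.2 i hin, hT0 i hi hin]
      simp [ι, w, hin]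
    -- The prescribed coefficient of order n - 1 is zero, so 0 is the unique zero defining `α`, and
    -- the jet at 0 is the jet at `α`.
    have hα0 : α (Y (ι w)) = 0 := by
      refine (hαu _ hw.1 0 h0ε ?_).symm
      have h2 := hjet (n - 1) (by omega) (by omega)
      rw [hμ0, div_eq_zero_iff] at h2
      exact h2.resolve_right (by positivity)
    refine ⟨_, hw, fun i hi hin => ?_⟩
    simp only [hlam]
    rw [hα0, hjet i hi hin]
  -- The neighbourhood is shrunk so that the parameters stay in the cube. Surjectivity survives,
  -- because the fields constructed above have parameters in the cube.
  refine ⟨(V ∩ N) ∩ ⋂ i ∈ Finset.Icc 1 (n - 2), (V ∩ N) ∩ lam i ⁻¹' Ioo (-η) η, ε, θ, η, T,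
    fun X => H (α X), fun X => T X (α X), lam n, lam, ?_, ?_, hε, hθ, hη, fun X hX => ?_,
    fun X hX => ?_, ?_, ?_, fun X _ => ?_, ?_, fun i hi => ⟨?_, fun X hX => ?_⟩,
    fun μ hμ => ?_, fun X hX => ?_, fun X hX => ?_⟩
  · refine hWo.inter (isOpen_biInter_finset fun i hi => ?_)
    rw [Finset.mem_Icc] at hi
    exact (hlamc i (by omega)).isOpen_inter_preimage hWo isOpen_Ioo
  · refine ⟨⟨hXV, hXN⟩, mem_iInter₂.2 fun i hi => ⟨⟨hXV, hXN⟩, ?_⟩⟩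
    rw [Finset.mem_Icc] at hi
    rw [mem_preimage, hlam0 i hi.1 (by omega)]
    exact ⟨by linarith, hη⟩
  · exact (hN X hX.1.2).1 ε le_rfl
  · exact hHdiff _ ((abs_lt.2 (hα X hX.1.1).1).trans_le hε'₁)
  · refine hHc.comp_continuousOn (ContinuousOn.prodMk ?_ continuousOn_snd)
    exact (hαc'.mono inter_subset_left).comp continuousOn_fst fun z hz => hz.1
  · exact (hH0 _).trans hαX₀
  · exact congrArg (T X) (hH0 _).symm
  · exact (hy.contDiff_zero.continuous.comp_continuousOn
      (continuousOn_id.prodMk hαc')).mono inter_subset_left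
  · rw [Finset.mem_Icc] at hi
    exact (hlamc i (by omega)).mono inter_subset_left
  · exact (mem_iInter₂.1 hX.2 i hi).2
  · obtain ⟨X, hX, hXμ⟩ := hsurj (fun i => if i ∈ Finset.Icc 1 (n - 2) then μ i else 0)
      (fun i _ => by
        split_ifs with hi
        · exact hμ i hi
        · exact ⟨by linarith, hη⟩)
      (if_neg fun hi => by
        have := Finset.mem_Icc.1 hi
        omega)
    have hXμ' : ∀ i ∈ Finset.Icc 1 (n - 2), lam i X = μ i := fun i hi => by
      have h1 := Finset.mem_Icc.1 hi
      rw [hXμ i h1.1 (by omega), if_pos hi]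
    refine ⟨X, ⟨hX, mem_iInter₂.2 fun i hi => ⟨hX, ?_⟩⟩, hXμ'⟩
    rw [mem_preimage, hXμ' i hi]
    exact hμ i hi
  -- Both the n-th derivative at `α X` and the n-th Lie derivative at the origin keep their signs
  -- from X₀, so the sign relation for X₀ transfers to `X`.
  · have h1 := (hα X hX.1.1).2.2
    have h2 := (hN X hX.1.2).2.1
    rw [hTn] at h1
    rw [← sign_eq_neg_sign_pow_mul_sign hv0 hE h1 h2]
    exact sign_eq_of_mul_pos (by
      have h3 : iteratedDeriv n (T X) (α X) ≠ 0 := right_ne_zero_of_mul h1.ne'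
      rw [div_mul_eq_mul_div]
      exact div_pos (mul_self_pos.2 h3) (by positivity))
  · have h1 := taylor_expansion_isBigO (n := n) (hTd X) (α X)
    refine h1.congr' ?_ EventuallyEq.rfl
    filter_upwards [hHloc (α X)] with x hx
    -- The Taylor sum splits into the terms 0, 1 to m, m + 1 and m + 2; the term m + 1 drops out by
    -- the choice of `α`.
    obtain ⟨m, rfl⟩ : ∃ m, n = m + 2 := ⟨n - 2, by omega⟩
    have h2 : iteratedDeriv (m + 1) (T X) (α X) = 0 := (hα X hX.1.1).2.1
    have h3 : Finset.range (m + 1) = insert 0 (Finset.Icc 1 m) := by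
      ext i
      simp only [Finset.mem_range, Finset.mem_insert, Finset.mem_Icc]
      omega
    rw [hx, Finset.sum_range_succ, Finset.sum_range_succ, h2, h3, Finset.sum_insert (by simp)]
    simp [hlam]
    ring
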